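/- Let $n\ge 1$ and $m>n$ be integers, put $r=m-n>0$, and let $\mathbf y=\mathbf H\mathbf s+\mathbf v$, where $\mathbf H\in\mathbb R^{n\times m}$ has i.i.d. Gaussian entries of mean zero and fixed non-zero variance, $\mathbf s$ is uniformly distributed on $\{-1,1\}^m$, $\mathbf v\in\mathbb R^n$ has i.i.d. Gaussian entries of mean zero and variance $\rho^{-1}$, $\rho>0$, and $\mathbf H,\mathbf s,\mathbf v$ are independent. Let $\mathbf X^\star=\mathbf X^\star(\mathbf H,\mathbf y)$ be a minimizer (chosen as a function of $\mathbf H$ and $\mathbf y$, in an arbitrary way if there are several) of $\mathrm{Tr}(\mathbf L\mathbf X)$ over all symmetric positive semidefinite $\mathbf X\in\mathbb R^{(m+1)\times(m+1)}$ whose diagonal entries are all $1$, where $$\mathbf L=\begin{bmatrix}\mathbf H^{\mathrm T}\mathbf H&-\mathbf H^{\mathrm T}\mathbf y\\-\mathbf y^{\mathrm T}\mathbf H&\mathbf y^{\mathrm T}\mathbf y\end{bmatrix},$$ and let the semidefinite relaxation (SDR) detector be $[\hat{\mathbf s}_{\mathrm{SDR}}]_i=1$ if $[\mathbf X^\star]_{i,m+1}>0$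 and $[\hat{\mathbf s}_{\mathrm{SDR}}]_i=-1$ otherwise, $i=1,\dots,m$. Then $$\limsup_{\rho\to\infty}\frac{\ln P(\hat{\mathbf s}_{\mathrm{SDR}}\neq\mathbf s)}{\ln\rho}\le -d,\qquad d=\frac12\left(m-\frac{r(r+3)}{2}\right),$$ where $\ln 0=-\infty$. -/

import Mathlib

open MeasureTheory ProbabilityTheory Filter Matrix
open scoped ENNReal NNReal

noncomputable section

namespace SDR

/-- The set `{-1, 1}^m` of binary messages. -/
def messages (m : ℕ) : Set (Fin m → ℝ) :=
  {b | ∀ i, b i = 1 ∨ b i = -1}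

/-- The real MIMO model `y = H s + v` at signal to noise ratio `ρ`: the entries of the `n × m`
channel matrix `H` are i.i.d. `N(0, σ2)`, the message `s` is uniform on `{-1, 1}^m`, the entries of
the noise `v` are i.i.d. `N(0, ρ⁻¹)`, and `H`, `s`, `v` are mutually independent. -/
structure IsGaussianModel {Ω : Type*} [MeasurableSpace Ω] (P : Measure Ω) {n m : ℕ}
    (σ2 : ℝ≥0) (ρ : ℝ) (H : Ω → Matrix (Fin n) (Fin m) ℝ) (s : Ω → Fin m → ℝ)
    (v : Ω → Fin n → ℝ) : Prop where
  channel_law : ∀ i j, HasLaw (fun ω => H ω i j) (gaussianReal 0 σ2) P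
  channel_indep : iIndepFun (fun (p : Fin n × Fin m) ω => H ω p.1 p.2) P
  message_law : HasLaw s (uniformOn (messages m)) P
  noise_law : ∀ i, HasLaw (fun ω => v ω i) (gaussianReal 0 (Real.toNNReal ρ⁻¹)) P
  noise_indep : iIndepFun (fun i ω => v ω i) P
  indep_channel_message :
    IndepFun (fun ω (p : Fin n × Fin m) => H ω p.1 p.2) s P
  indep_noise :
    IndepFun (fun ω => ((fun p : Fin n × Fin m => H ω p.1 p.2), s ω)) v P

/-- The received vector `y = H s + v`. -/
def received {n m : ℕ} (H : Matrix (Fin n) (Fin m) ℝ) (s : Fin m → ℝ) (v : Fin n → ℝ) :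
    Fin n → ℝ :=
  H *ᵥ s + v

/-- The cost matrix `L = [HᵀH, -Hᵀy; -yᵀH, yᵀy]`. The last index is `Sum.inr ()`. -/
def costMatrix {n m : ℕ} (H : Matrix (Fin n) (Fin m) ℝ) (y : Fin n → ℝ) :
    Matrix (Fin m ⊕ Unit) (Fin m ⊕ Unit) ℝ :=
  Matrix.fromBlocks (Hᵀ * H) (-(Hᵀ * replicateCol Unit y))
    (-(replicateRow Unit y * H)) (replicateRow Unit y * replicateCol Unit y)

/-- The feasible set of the semidefinite relaxation: symmetric positive semidefinite matrices of
order `m + 1` with unit diagonal. -/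
def feasible (m : ℕ) : Set (Matrix (Fin m ⊕ Unit) (Fin m ⊕ Unit) ℝ) :=
  {X | X.PosSemidef ∧ ∀ k, X k k = 1}

/-- `X` is an optimal point of the semidefinite relaxation: minimize `Tr(L X)` over the
feasible set. -/
def IsOptimal {n m : ℕ} (H : Matrix (Fin n) (Fin m) ℝ) (y : Fin n → ℝ)
    (X : Matrix (Fin m ⊕ Unit) (Fin m ⊕ Unit) ℝ) : Prop :=
  X ∈ feasible m ∧
    ∀ Z ∈ feasible m, (costMatrix H y * X).trace ≤ (costMatrix H y * Z).trace

/-- The sign function with value `-1` at zero. -/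
def sgn (x : ℝ) : ℝ := if 0 < x then 1 else -1

/-- Rounding: the signs of the last column of `X`. -/
def rounded {m : ℕ} (X : Matrix (Fin m ⊕ Unit) (Fin m ⊕ Unit) ℝ) : Fin m → ℝ :=
  fun i => sgn (X (Sum.inl i) (Sum.inr ()))

/-- The event that the semidefinite relaxation detector, which rounds the optimal point
`Xstar H y`, decides for a message different from the transmitted one. -/
def errorEvent {Ω : Type*} {n m : ℕ}
    (Xstar : Matrix (Fin n) (Fin m) ℝ → (Fin n → ℝ) → Matrix (Fin m ⊕ Unit) (Fin m ⊕ Unit) ℝ)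
    (H : Ω → Matrix (Fin n) (Fin m) ℝ) (s : Ω → Fin m → ℝ) (v : Ω → Fin n → ℝ) : Set Ω :=
  {ω | rounded (Xstar (H ω) (received (H ω) (s ω) (v ω))) ≠ s ω}

end SDR

end

/-!
The proof bounds the error probability by `C (log ρ)^B ρ^{-d}`; the factor `(log ρ)^B` disappears
in the limit, and for `d ≤ 0` there is nothing to prove.

*Geometry.* Write an optimal point as a Gram matrix of unit vectors `b_1, …, b_m, b_0` and put
`u_i = b_0 - s_i b_i`, `c = 2 b_0`. Then `‖u_i‖² = ⟪u_i, c⟫`, so that all `u_i` lie on one sphere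
through the origin. An error forces some `‖u_i‖² ≥ 2`, and comparison with the feasible point
`(s, 1)(s, 1)ᵀ` gives `‖∑_i H_{ai} s_i u_i‖ = O(‖v‖)` for every row `a` of the channel matrix
(`exists_sphere_of_error`). So an error requires a nontrivial configuration on a sphere which `H`
almost annihilates.

*Discretization.* Gram-Schmidt on the `u_i`, always choosing the largest remaining residual as the
next pivot and stopping at residual `1 / M`, gives coordinates in which the pivot rows are lower
triangular and the `j`-th coordinate of every row is bounded by the `j`-th pivot
(`exists_pivotFrame`). Rounding to the grid of width `1 / M`, with `M ≈ ρ^{1/2} / log ρ`, turns the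
configuration into an integer matrix `A` with pivots `1 ≤ T_j ≤ T_0 = M`
(`exists_admissible_of_sphere`).

*Counting.* The sphere has radius comparable to `M` on the grid scale, so one of its wide
coordinates is transversal to it and can be solved for (`slab_card_le`). The pivot rows determine
the center of the sphere, hence there are at most `C M^{-m} ∏_j T_j^{m-j}` matrices with given
pivots (`admissible_card_le`).

*Probability.* For fixed `A`, successive integration over the Gaussian entries of `H` at the pivot
positions bounds the probability that all entries of `H diag(s) A` are at most `K` by
`∏_j (C K / T_j)^n` (`measure_forall_triangular_le`).

The product of the two bounds, with `m = n + r`, is a constant times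
`K^{O(1)} M^{-n} ∏_{j ≥ 1} T_j^{r-j}`. Its sum over `T` is of order `M^{-n + r(r+1)/2}`, up to
logarithms, and `n - r(r+1)/2 = m - r(r+3)/2 = 2d`. All scales of the pivots are treated at once, so
that no distribution of singular values is needed.
-/

namespace SDR

/-! ### Counting functions coordinate by coordinate -/

/-- A dependent product bound: if the coordinates are ordered by a rank, and coordinate `i` takes at
most `B i` values once all coordinates of lower rank are prescribed, then a set of functions has
at most `∏ i, B i` elements. -/
theorem card_le_prod_of_rank {ι β : Type*} [Fintype ι]
    (S : Finset (ι → β)) (rk : ι → ℕ) (B : ι → ℝ) (hB₀ : ∀ i, 0 ≤ B i)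
    (h : ∀ A ∈ S, ∀ i, ∀ Y : Finset β,
      (∀ y ∈ Y, ∃ A' ∈ S, (∀ l, rk l < rk i → A' l = A l) ∧ A' i = y) → (Y.card : ℝ) ≤ B i) :
    (S.card : ℝ) ≤ ∏ i, B i := by
  classical
  rcases S.eq_empty_or_nonempty with rfl | ⟨A₀, hA₀⟩
  · simpa using Finset.prod_nonneg fun i _ => hB₀ i
  have hB : ∀ i, 1 ≤ B i := by
    intro i
    simpa using h A₀ hA₀ i {A₀ i} (by simpa using ⟨A₀, hA₀, fun l _ => rfl, rfl⟩)
  let R : ℕ → (ι → β) → (ι → β) := fun N A i => if rk i < N then A i else A₀ i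
  have key : ∀ N, ((S.image (R N)).card : ℝ) ≤ ∏ i, if rk i < N then B i else 1 := by
    intro N
    induction N with
    | zero =>
      have : S.image (R 0) = {A₀} := by
        ext A
        simp only [Finset.mem_image, Finset.mem_singleton]
        constructor
        · rintro ⟨A', -, rfl⟩
          funext i; simp [R]
        · rintro rfl
          exact ⟨A, hA₀, by funext i; simp [R]⟩
      simp [this]
    | succ N ih =>
      have himg : (S.image (R (N + 1))).image (R N) = S.image (R N) := by
        rw [Finset.image_image]
        congr 1
        funext A i
        simp only [Function.comp, R]
        split_ifs <;> first | rfl | omega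
      have hfib : ∀ a ∈ (S.image (R (N + 1))).image (R N),
          (((S.image (R (N + 1))).filter fun x => R N x = a).card : ℝ) ≤
            ∏ i, if rk i = N then B i else 1 := by
        intro a ha
        rw [himg] at ha
        obtain ⟨A, hA, rfl⟩ := Finset.mem_image.1 ha
        let V : ι → Finset β := fun i => if rk i = N then
          ((S.filter fun A' => ∀ l, rk l < rk i → A' l = A l).image fun A' => A' i) else {R N A i}
        have hsub : ((S.image (R (N + 1))).filter fun x => R N x = R N A) ⊆
            Fintype.piFinset V := by
          intro x hx
          obtain ⟨hx1, hx2⟩ := Finset.mem_filter.1 hx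
          obtain ⟨A', hA', rfl⟩ := Finset.mem_image.1 hx1
          rw [Fintype.mem_piFinset]
          intro i
          have hx2' : ∀ l, R N (R (N + 1) A') l = R N A l := fun l => by rw [hx2]
          by_cases hi : rk i = N
          · simp only [V, if_pos hi]
            refine Finset.mem_image.2 ⟨A', Finset.mem_filter.2 ⟨hA', ?_⟩, ?_⟩
            · intro l hl
              have := hx2' l
              simp only [R] at this
              rw [if_pos (by omega), if_pos (by omega), if_pos (by omega)] at this
              exact this
            · simp only [R]; rw [if_pos (by omega)]
          · simp only [V, if_neg hi, Finset.mem_singleton]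
            rw [← hx2' i]
            simp only [R]
            split_ifs <;> first | rfl | omega
        refine le_trans (Nat.cast_le.2 (Finset.card_le_card hsub)) ?_
        rw [Fintype.card_piFinset]
        push_cast
        refine Finset.prod_le_prod (fun i _ => by positivity) fun i _ => ?_
        by_cases hi : rk i = N
        · simp only [V, if_pos hi]
          refine h A hA i _ fun y hy => ?_
          obtain ⟨A', hA', rfl⟩ := Finset.mem_image.1 hy
          obtain ⟨h1, h2⟩ := Finset.mem_filter.1 hA'
          exact ⟨A', h1, h2, rfl⟩
        · simp [V, if_neg hi]
      have hmul : ((S.image (R (N + 1))).card : ℝ) ≤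
          (S.image (R N)).card * ∏ i, if rk i = N then B i else 1 := by
        rw [Finset.card_eq_sum_card_image (R N), himg]
        push_cast
        rw [← nsmul_eq_mul]
        exact Finset.sum_le_card_nsmul _ _ _ (by rwa [himg] at hfib)
      refine hmul.trans ((mul_le_mul_of_nonneg_right ih ?_).trans ?_)
      · exact Finset.prod_nonneg fun i _ => by
          split_ifs
          · linarith [hB i]
          · norm_num
      · rw [← Finset.prod_mul_distrib]
        refine le_of_eq (Finset.prod_congr rfl fun i _ => ?_)
        by_cases h1 : rk i < N
        · rw [if_pos h1, if_neg (by omega), if_pos (by omega), mul_one]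
        · by_cases h2 : rk i = N
          · rw [if_neg h1, if_pos h2, if_pos (by omega), one_mul]
          · rw [if_neg h1, if_neg h2, if_neg (by omega), one_mul]
  obtain ⟨N, hN⟩ : ∃ N, ∀ i, rk i < N := 
    ⟨Finset.univ.sup rk + 1, fun i => Nat.lt_succ_of_le (Finset.le_sup (Finset.mem_univ i))⟩
  have := key N
  simp only [hN, if_true] at this
  have hid : R N = id := by funext A i; simp [R, hN]
  rwa [hid, Finset.image_id] at this

/-! ### Lattice points near a sphere in a box -/

theorem int_card_le_of_abs_sub_le (Y : Finset ℤ) {D : ℝ} (hD : 0 ≤ D)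
    (h : ∀ x ∈ Y, ∀ y ∈ Y, |(x : ℝ) - y| ≤ D) : (Y.card : ℝ) ≤ D + 1 := by
  rcases Y.eq_empty_or_nonempty with rfl | hne
  · simp; linarith
  have hsub : Y ⊆ Finset.Icc (Y.min' hne) (Y.max' hne) := fun x hx =>
    Finset.mem_Icc.2 ⟨Y.min'_le x hx, Y.le_max' x hx⟩
  have h1 := Finset.card_le_card hsub
  rw [Int.card_Icc] at h1
  have h2 := h _ (Y.max'_mem hne) _ (Y.min'_mem hne)
  have h3 : Y.min' hne ≤ Y.max' hne := Y.min'_le _ (Y.max'_mem hne)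
  have h4 : (Y.card : ℤ) ≤ Y.max' hne + 1 - Y.min' hne := by omega
  have h5 : (Y.card : ℝ) ≤ Y.max' hne + 1 - Y.min' hne := by exact_mod_cast h4
  have := le_abs_self ((Y.max' hne : ℝ) - Y.min' hne)
  linarith

/-- The points where a parabola takes values in a given interval, counted away from its vertex:
there the slope is at least `δ`, so on each branch they lie in a short interval. -/
theorem int_card_le_of_sq_near (Y : Finset ℤ) {g w δ E : ℝ} (hδ : 0 < δ) (hE : 0 ≤ E)
    (hfar : ∀ y ∈ Y, δ ≤ |2 * (y : ℝ) - g|) (hsq : ∀ y ∈ Y, |(2 * (y : ℝ) - g) ^ 2 - w| ≤ E) :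
    (Y.card : ℝ) ≤ 2 * (E / (2 * δ) + 1) := by
  have aux : ∀ a b : ℝ, δ ≤ a → δ ≤ b → |a ^ 2 - w| ≤ E → |b ^ 2 - w| ≤ E →
      |a - b| ≤ E / δ := by
    intro a b ha hb h1 h2
    rw [le_div_iff₀ hδ]
    have h3 : |a - b| * |a + b| ≤ 2 * E := by
      rw [← abs_mul, abs_le]
      rw [abs_le] at h1 h2
      constructor <;> nlinarith
    rw [abs_of_nonneg (by linarith : 0 ≤ a + b)] at h3
    nlinarith [abs_nonneg (a - b)]
  have hpos := int_card_le_of_abs_sub_le (Y.filter fun y => 0 < 2 * (y : ℝ) - g)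
    (D := E / (2 * δ)) (by positivity) (by
      intro x hx y hy
      obtain ⟨hx, hx'⟩ := Finset.mem_filter.1 hx
      obtain ⟨hy, hy'⟩ := Finset.mem_filter.1 hy
      have h1 := hfar x hx
      have h2 := hfar y hy
      rw [abs_of_pos hx'] at h1
      rw [abs_of_pos hy'] at h2
      have := aux _ _ h1 h2 (hsq x hx) (hsq y hy)
      rw [show 2 * (x : ℝ) - g - (2 * y - g) = 2 * (x - y) by ring, abs_mul, abs_two] at this
      rw [mul_comm 2 δ, ← div_div]
      linarith)
  have hneg := int_card_le_of_abs_sub_le (Y.filter fun y => ¬ 0 < 2 * (y : ℝ) - g)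
    (D := E / (2 * δ)) (by positivity) (by
      intro x hx y hy
      obtain ⟨hx, hx'⟩ := Finset.mem_filter.1 hx
      obtain ⟨hy, hy'⟩ := Finset.mem_filter.1 hy
      have h1 := hfar x hx
      have h2 := hfar y hy
      rw [abs_of_nonpos (not_lt.1 hx')] at h1
      rw [abs_of_nonpos (not_lt.1 hy')] at h2
      have := aux _ _ h1 h2 (by rw [neg_sq]; exact hsq x hx) (by rw [neg_sq]; exact hsq y hy)
      rw [show -(2 * (x : ℝ) - g) - -(2 * y - g) = -(2 * (x - y)) by ring, abs_neg, abs_mul,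
        abs_two] at this
      rw [mul_comm 2 δ, ← div_div]
      linarith)
  have := Finset.card_filter_add_card_filter_not (s := Y) (fun y => 0 < 2 * (y : ℝ) - g)
  have h' := congrArg (Nat.cast (R := ℝ)) this
  push_cast at h'
  linarith

/-- The constant in the lattice point count `slab_card_le` in dimension `k`. Only its
independence of the box matters. -/
def slabConst (k : ℕ) : ℝ := 2560 * (k : ℝ) ^ 3 * 5 ^ k

theorem int_card_box (Y : Finset ℤ) {t : ℕ} (ht : 1 ≤ t) (h : ∀ y ∈ Y, |y| ≤ 2 * (t : ℤ)) :
    (Y.card : ℝ) ≤ 5 * t := by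
  have hsub : Y ⊆ Finset.Icc (-(2 * (t : ℤ))) (2 * t) := fun y hy =>
    Finset.mem_Icc.2 (abs_le.1 (h y hy))
  have h1 := Finset.card_le_card hsub
  rw [Int.card_Icc] at h1
  have : Y.card ≤ 5 * t := by omega
  exact_mod_cast this

theorem int_card_le_one (Y : Finset ℤ) (h : ∀ x ∈ Y, ∀ y ∈ Y, x = y) : (Y.card : ℝ) ≤ 1 := by
  exact_mod_cast Finset.card_le_one.2 h

/-- Near the sphere `∑ a_j (a_j - γ_j) = 0`, whose radius is comparable to `M`, some coordinate `l` of
large range `T l` has a normal component `2 a_l - γ_l` comparable to `M`: the coordinates of small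
range contribute too little for all the wide ones to be close to the center. -/
theorem exists_transversal_coordinate {ι : Type*} [Fintype ι] (J : Finset ι) {i₀ : ι}
    (hi₀ : i₀ ∈ J) {M : ℝ} (hM : 0 < M)
    (T : ι → ℝ) (hTi₀ : T i₀ = M)
    (γ : ι → ℝ) (hγ : ∀ j ∈ J, |γ j| ≤ 2 * M) (hγ₀ : |γ i₀ - M| ≤ M / 4)
    {E : ℝ} (hE : E ≤ M ^ 2 / 32) (a : ι → ℝ) (ha : ∀ j ∈ J, |a j| ≤ 2 * T j)
    (hs : |∑ j ∈ J, a j * (a j - γ j)| ≤ E) :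
    ∃ l ∈ J, M / (256 * Fintype.card ι) ≤ T l ∧ M / (2 * Fintype.card ι) ≤ |2 * a l - γ l| := by
  have hk : 1 ≤ (Fintype.card ι : ℝ) := by
    exact_mod_cast Fintype.card_pos_iff.2 ⟨i₀⟩
  set k : ℝ := (Fintype.card ι : ℝ) with hkdef
  by_contra! hcon
  let L := J.filter fun j => M / (256 * k) ≤ T j
  have hcard : ∀ s : Finset ι, (s.card : ℝ) ≤ k := fun s => by
    rw [hkdef]; exact_mod_cast Finset.card_le_univ s
  have h1 : ∑ j ∈ L, (2 * a j - γ j) ^ 2 ≤ M ^ 2 / 4 := by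
    have : ∀ j ∈ L, (2 * a j - γ j) ^ 2 ≤ M ^ 2 / (4 * k) := by
      intro j hj
      obtain ⟨hj, hj'⟩ := Finset.mem_filter.1 hj
      have := hcon j hj hj'
      rw [← sq_abs]
      calc |2 * a j - γ j| ^ 2 ≤ (M / (2 * k)) ^ 2 := by gcongr
        _ = M ^ 2 / (4 * k) / k := by field_simp; norm_num
        _ ≤ M ^ 2 / (4 * k) := div_le_self (by positivity) hk
    calc _ ≤ L.card • (M ^ 2 / (4 * k)) := Finset.sum_le_card_nsmul _ _ _ this
      _ ≤ k * (M ^ 2 / (4 * k)) := by rw [nsmul_eq_mul]; gcongr; exact hcard L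
      _ = M ^ 2 / 4 := by field_simp
  have hi₀L : i₀ ∈ L := by
    refine Finset.mem_filter.2 ⟨hi₀, ?_⟩
    rw [hTi₀]
    exact div_le_self hM.le (by linarith)
  have h2 : (9 / 16) * M ^ 2 ≤ ∑ j ∈ L, γ j ^ 2 := by
    refine le_trans ?_ (Finset.single_le_sum (f := fun j => γ j ^ 2) (fun j _ => sq_nonneg _) hi₀L)
    have := (abs_le.1 hγ₀).1
    have h3 : 3 / 4 * M ≤ γ i₀ := by linarith
    calc (9 / 16) * M ^ 2 = (3 / 4 * M) ^ 2 := by ring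
      _ ≤ γ i₀ ^ 2 := by gcongr
  have h3 : ∑ j ∈ L, (2 * a j - γ j) ^ 2 =
      4 * (∑ j ∈ L, a j * (a j - γ j)) + ∑ j ∈ L, γ j ^ 2 := by
    rw [Finset.mul_sum, ← Finset.sum_add_distrib]
    exact Finset.sum_congr rfl fun j _ => by ring
  have h4 : |∑ j ∈ J.filter (fun j => ¬ M / (256 * k) ≤ T j), a j * (a j - γ j)| ≤ M ^ 2 / 32 := by
    have : ∀ j ∈ J.filter (fun j => ¬ M / (256 * k) ≤ T j),
        |a j * (a j - γ j)| ≤ M ^ 2 / (32 * k) := by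
      intro j hj
      obtain ⟨hj, hj'⟩ := Finset.mem_filter.1 hj
      rw [not_le] at hj'
      have h5 := ha j hj
      have h6 := hγ j hj
      have h7 : M / (256 * k) ≤ M := div_le_self hM.le (by linarith)
      have h8 : |a j - γ j| ≤ 4 * M := by
        have := abs_sub (a j) (γ j)
        linarith
      rw [abs_mul]
      calc |a j| * |a j - γ j| ≤ (2 * (M / (256 * k))) * (4 * M) := by
            gcongr
            linarith
        _ = M ^ 2 / (32 * k) := by field_simp; norm_num
    calc _ ≤ ∑ j ∈ J.filter (fun j => ¬ M / (256 * k) ≤ T j), |a j * (a j - γ j)| :=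
          Finset.abs_sum_le_sum_abs _ _
      _ ≤ (J.filter (fun j => ¬ M / (256 * k) ≤ T j)).card • (M ^ 2 / (32 * k)) :=
          Finset.sum_le_card_nsmul _ _ _ this
      _ ≤ k * (M ^ 2 / (32 * k)) := by rw [nsmul_eq_mul]; gcongr; exact hcard _
      _ = M ^ 2 / 32 := by field_simp
  have h5 := Finset.sum_filter_add_sum_filter_not J (fun j => M / (256 * k) ≤ T j)
    (fun j => a j * (a j - γ j))
  change ∑ j ∈ L, a j * (a j - γ j) + _ = _ at h5
  rw [abs_le] at h4 hs
  nlinarith [sq_pos_of_pos hM]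

/-- A neighborhood of a sphere through the origin, with radius comparable to `M`, occupies at most a
fraction `E / M ^ 2` of a coordinate box, up to a constant. The box may be thin in all directions
but the one of `i₀`. Coordinates outside `J` are frozen. -/
theorem slab_card_le {ι : Type*} [Fintype ι] (J : Finset ι) {i₀ : ι} (hi₀ : i₀ ∈ J) {M : ℕ}
    (hM : 0 < M)
    (T : ι → ℕ) (hT : ∀ j ∈ J, 1 ≤ T j) (hTi₀ : T i₀ = M)
    (γ : ι → ℝ) (hγ : ∀ j ∈ J, |γ j| ≤ 2 * M) (hγ₀ : |γ i₀ - M| ≤ M / 4)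
    {E : ℝ} (hE : M ≤ E) (S : Finset (ι → ℤ)) (hbox : ∀ a ∈ S, ∀ j ∈ J, |a j| ≤ 2 * (T j : ℤ))
    (hfix : ∀ a ∈ S, ∀ b ∈ S, ∀ j ∉ J, a j = b j)
    (hs : ∀ a ∈ S, |∑ j ∈ J, (a j : ℝ) * (a j - γ j)| ≤ E) :
    (S.card : ℝ) ≤ slabConst (Fintype.card ι) * (E / M ^ 2) * ∏ j ∈ J, (T j : ℝ) := by
  classical
  have hk : 1 ≤ (Fintype.card ι : ℝ) := by
    exact_mod_cast Fintype.card_pos_iff.2 ⟨i₀⟩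
  have hEp : 0 ≤ E := (Nat.cast_nonneg M).trans hE
  set N := Fintype.card ι with hN
  set k : ℝ := (N : ℝ) with hkdef
  have hMR : (0 : ℝ) < M := by exact_mod_cast hM
  have hprod1 : ∀ s : Finset ι, ∏ j ∈ s, (5 : ℝ) ≤ 5 ^ N := fun s => by
    rw [Finset.prod_const]
    exact pow_le_pow_right₀ (by norm_num) (Finset.card_le_univ s)
  have hPnn : 0 ≤ ∏ j ∈ J, (T j : ℝ) := Finset.prod_nonneg fun j _ => by positivity
  -- A shell this thick is no restriction: the whole box already satisfies the bound.
  by_cases hE' : E ≤ (M : ℝ) ^ 2 / 32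
  swap
  · have hc := card_le_prod_of_rank S (fun _ => 0) (fun j => if j ∈ J then 5 * (T j : ℝ) else 1)
      (fun j => by positivity) (by
        intro A hA j Y hY
        by_cases hj : j ∈ J
        · simp only [hj, if_true]
          refine int_card_box _ (hT j hj) ?_
          intro y hy
          obtain ⟨b, hb, hb2, rfl⟩ := hY _ hy
          exact hbox b hb j hj
        · simp only [hj, if_false]
          refine int_card_le_one _ ?_
          intro x hx y hy
          obtain ⟨b, hb, -, rfl⟩ := hY _ hx
          obtain ⟨c, hc, -, rfl⟩ := hY _ hy
          exact hfix b hb c hc j hj)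
    refine hc.trans ?_
    rw [← Finset.prod_filter, Finset.filter_mem_eq_inter, Finset.univ_inter,
      Finset.prod_mul_distrib]
    refine mul_le_mul_of_nonneg_right ((hprod1 J).trans ?_) hPnn
    have h1 : 1 / 32 ≤ E / (M : ℝ) ^ 2 := by
      rw [le_div_iff₀ (by positivity)]; linarith
    have h2 : (1 : ℝ) ≤ k ^ 3 := one_le_pow₀ hk
    have h5 : (0 : ℝ) < 5 ^ N := by positivity
    calc (5 : ℝ) ^ N ≤ (2560 * 1 * 5 ^ N) * (1 / 32) := by nlinarith
      _ ≤ slabConst N * (E / M ^ 2) := by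
        unfold slabConst
        gcongr
  · let W : ι → Finset (ι → ℤ) := fun l => S.filter fun a =>
      M / (256 * k) ≤ T l ∧ M / (2 * k) ≤ |2 * (a l : ℝ) - γ l|
    have hcover : S ⊆ J.biUnion W := by
      intro a ha
      obtain ⟨l, hl, h1, h2⟩ := exists_transversal_coordinate J hi₀ hMR (fun j => (T j : ℝ))
        (by simp [hTi₀]) γ hγ hγ₀ hE' (fun j => (a j : ℝ))
        (fun j hj => by exact_mod_cast hbox a ha j hj) (hs a ha)
      exact Finset.mem_biUnion.2 ⟨l, hl, Finset.mem_filter.2 ⟨ha, h1, h2⟩⟩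
    have hW : ∀ l ∈ J, ((W l).card : ℝ) ≤
        2560 * k ^ 2 * 5 ^ N * (E / M ^ 2) * ∏ j ∈ J, (T j : ℝ) := by
      intro l hl
      -- A member of `W l` is needed only to know that the range `T l` is large.
      rcases (W l).eq_empty_or_nonempty with he | ⟨a₀, ha₀⟩
      · rw [he]; simp; positivity
      have hTl : M / (256 * k) ≤ T l := (Finset.mem_filter.1 ha₀).2.1
      have hc := card_le_prod_of_rank (W l) (fun j => if j = l then 1 else 0)
        (fun j => if j = l then 10 * k * E / M else if j ∈ J then 5 * (T j : ℝ) else 1)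
        (fun j => by positivity) (by
          intro A hA j Y hY
          by_cases hjl : j = l
          · subst hjl
            simp only [if_true]
            -- With all coordinates but `j` prescribed, the sphere equation is a quadratic in `a j`.
            refine (int_card_le_of_sq_near _ (g := γ j) (δ := M / (2 * k)) (E := 4 * E)
              (w := ∑ i ∈ J, γ i ^ 2 - ∑ i ∈ J.erase j, (2 * (A i : ℝ) - γ i) ^ 2) (by positivity)
              (by linarith) ?_ ?_).trans ?_
            · intro y hy
              obtain ⟨b, hb, hb2, rfl⟩ := hY _ hy
              exact (Finset.mem_filter.1 hb).2.2
            · intro y hy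
              obtain ⟨b, hb, hb2, rfl⟩ := hY _ hy
              have hb3 := hs b (Finset.mem_filter.1 hb).1
              have hsum : ∑ i ∈ J.erase j, (2 * (A i : ℝ) - γ i) ^ 2 =
                  ∑ i ∈ J.erase j, (2 * (b i : ℝ) - γ i) ^ 2 := by
                refine Finset.sum_congr rfl fun i hi => ?_
                rw [hb2 i (by simp [Finset.ne_of_mem_erase hi])]
              have h3 : ∑ i ∈ J, (2 * (b i : ℝ) - γ i) ^ 2 =
                  4 * (∑ i ∈ J, (b i : ℝ) * (b i - γ i)) + ∑ i ∈ J, γ i ^ 2 := by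
                rw [Finset.mul_sum, ← Finset.sum_add_distrib]
                exact Finset.sum_congr rfl fun j _ => by ring
              rw [← Finset.add_sum_erase J _ hl] at h3
              rw [hsum]
              rw [show (2 * (b j : ℝ) - γ j) ^ 2 - (∑ i ∈ J, γ i ^ 2 -
                ∑ i ∈ J.erase j, (2 * (b i : ℝ) - γ i) ^ 2) =
                4 * (∑ i ∈ J, (b i : ℝ) * (b i - γ i)) by linarith, abs_mul]
              norm_num
              linarith
            · have h1 : 4 * E / (2 * (M / (2 * k))) = 4 * k * (E / M) := by field_simp
              have h2 : 1 ≤ E / M := (one_le_div hMR).2 hE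
              rw [h1, mul_div_assoc]
              nlinarith
          · simp only [hjl, if_false]
            by_cases hj : j ∈ J
            · simp only [hj, if_true]
              refine int_card_box _ (hT j hj) ?_
              intro y hy
              obtain ⟨b, hb, hb2, rfl⟩ := hY _ hy
              exact hbox b (Finset.mem_filter.1 hb).1 j hj
            · simp only [hj, if_false]
              refine int_card_le_one _ ?_
              intro x hx y hy
              obtain ⟨b, hb, -, rfl⟩ := hY _ hx
              obtain ⟨c, hc, -, rfl⟩ := hY _ hy
              exact hfix b (Finset.mem_filter.1 hb).1 c
                (Finset.mem_filter.1 hc).1 j hj)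
      refine hc.trans ?_
      have hsplit : (∏ j, if j = l then 10 * k * E / M else if j ∈ J then 5 * (T j : ℝ) else 1) =
          (10 * k * E / M) * ((∏ j ∈ J.erase l, (5 : ℝ)) * ∏ j ∈ J.erase l, (T j : ℝ)) := by
        rw [← Finset.mul_prod_erase Finset.univ _ (Finset.mem_univ l), if_pos rfl,
          ← Finset.prod_mul_distrib]
        congr 1
        rw [← Finset.prod_subset (Finset.erase_subset_erase l (Finset.subset_univ J))]
        · refine Finset.prod_congr rfl fun j hj => ?_
          rw [if_neg (Finset.ne_of_mem_erase hj), if_pos (Finset.mem_of_mem_erase hj)]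
        · intro j hj hj'
          have hne := Finset.ne_of_mem_erase hj
          rw [if_neg hne, if_neg]
          exact fun h => hj' (Finset.mem_erase.2 ⟨hne, h⟩)
      rw [hsplit, ← Finset.mul_prod_erase J _ hl]
      have hQ : 0 ≤ ∏ j ∈ J.erase l, (T j : ℝ) := Finset.prod_nonneg fun j _ => by positivity
      calc 10 * k * E / M * ((∏ j ∈ J.erase l, (5 : ℝ)) * ∏ j ∈ J.erase l, (T j : ℝ))
          ≤ 10 * k * E / M * (5 ^ N * ∏ j ∈ J.erase l, (T j : ℝ)) := by
            gcongr
            exact hprod1 _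
        _ = 2560 * k ^ 2 * 5 ^ N * (E / M ^ 2) *
            ((M / (256 * k)) * ∏ j ∈ J.erase l, (T j : ℝ)) := by field_simp; ring
        _ ≤ _ := by gcongr
    calc (S.card : ℝ) ≤ ∑ l ∈ J, ((W l).card : ℝ) := by
          exact_mod_cast (Finset.card_le_card hcover).trans Finset.card_biUnion_le
      _ ≤ J.card • (2560 * k ^ 2 * 5 ^ N * (E / M ^ 2) * ∏ j ∈ J, (T j : ℝ)) :=
          Finset.sum_le_card_nsmul _ _ _ hW
      _ ≤ k * (2560 * k ^ 2 * 5 ^ N * (E / M ^ 2) * ∏ j ∈ J, (T j : ℝ)) := by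
          rw [nsmul_eq_mul]
          gcongr
          rw [hkdef]; exact_mod_cast Finset.card_le_univ J
      _ = _ := by unfold slabConst; ring

/-! ### Counting admissible integer matrices -/

/-- The integer matrix `A` has lower triangular pivot rows `p k` with pivots `T k`, the column
`j` is bounded by `2 * T j`, and all its rows lie near a sphere through the origin with diameter `γ`,
up to an error `C * M` on the squared scale. The diameter is normalized by `γ 0 = M`. -/
structure Admissible {m d : ℕ} (C : ℝ) (M : ℕ) (p : Fin (d + 1) → Fin m) (T : Fin (d + 1) → ℕ)
    (A : Fin m → Fin (d + 1) → ℤ) : Prop where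
  box : ∀ i j, |A i j| ≤ 2 * (T j : ℤ)
  diag : ∀ k, A (p k) k = T k
  upper : ∀ k j, k < j → A (p k) j = 0
  center : ∃ γ : Fin (d + 1) → ℝ, (∀ j, |γ j| ≤ 2 * M) ∧ γ 0 = M ∧
    ∀ i, |∑ j, (A i j : ℝ) * (A i j - γ j)| ≤ C * M

theorem sum_eq_sum_Iio_add {d : ℕ} (k : Fin d) (f : Fin d → ℝ) (h : ∀ j, k < j → f j = 0) :
    ∑ j, f j = ∑ j ∈ Finset.Iio k, f j + f k := by
  rw [← Finset.sum_subset (Finset.subset_univ (Finset.Iic k))]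
  · rw [← Finset.Iio_insert k, Finset.sum_insert (by simp), add_comm]
  · intro j _ hj
    exact h j (by simpa using hj)

theorem two_mul_sum_Iio_three_pow {d : ℕ} (k : Fin d) :
    2 * ∑ j ∈ Finset.Iio k, (3 : ℝ) ^ (j : ℕ) = 3 ^ (k : ℕ) - 1 := by
  have : ∑ j ∈ Finset.Iio k, (3 : ℝ) ^ (j : ℕ) = ∑ j ∈ Finset.range k, (3 : ℝ) ^ j := by
    rw [← Nat.Iio_eq_range, ← Fin.map_valEmbedding_Iio, Finset.sum_map]
    rfl
  rw [this, geom_sum_eq (by norm_num)]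
  ring

/-- The pivot rows determine the diameter of the sphere: if two admissible matrices agree on the pivot
rows up to `k`, then the `k`-th coordinates of their diameters differ by `O(M / T k)`. This is the
triangular system given by the sphere equations of the pivot rows. -/
theorem center_stable {m d : ℕ} {C : ℝ} {M : ℕ} {p : Fin (d + 1) → Fin m}
    {T : Fin (d + 1) → ℕ} {A A' : Fin m → Fin (d + 1) → ℤ} (hA : Admissible C M p T A)
    {γ γ' : Fin (d + 1) → ℝ} (hγ : ∀ i, |∑ j, (A i j : ℝ) * (A i j - γ j)| ≤ C * M)
    (hγ' : ∀ i, |∑ j, (A' i j : ℝ) * (A' i j - γ' j)| ≤ C * M)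
    (k : Fin (d + 1)) (heq : ∀ l ≤ k, A' (p l) = A (p l)) :
    (T k : ℝ) * |γ k - γ' k| ≤ 2 * C * 3 ^ (k : ℕ) * M := by
  induction k using WellFoundedLT.induction with
  | ind k ih =>
  have hrow : |∑ j, (A (p k) j : ℝ) * (γ j - γ' j)| ≤ 2 * C * M := by
    have h1 := hγ (p k)
    have h2 := hγ' (p k)
    rw [heq k le_rfl] at h2
    have h3 : ∑ j, (A (p k) j : ℝ) * (γ j - γ' j) =
        ∑ j, (A (p k) j : ℝ) * (A (p k) j - γ' j) - ∑ j, (A (p k) j : ℝ) * (A (p k) j - γ j) := by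
      rw [← Finset.sum_sub_distrib]
      exact Finset.sum_congr rfl fun j _ => by ring
    rw [h3]
    refine (abs_sub _ _).trans ?_
    linarith
  rw [sum_eq_sum_Iio_add k _ (fun j hj => by rw [hA.upper k j hj]; simp), hA.diag k] at hrow
  have hlow : |∑ j ∈ Finset.Iio k, (A (p k) j : ℝ) * (γ j - γ' j)| ≤
      2 * C * M * (3 ^ (k : ℕ) - 1) := by
    refine (Finset.abs_sum_le_sum_abs _ _).trans ?_
    rw [← two_mul_sum_Iio_three_pow, Finset.mul_sum, Finset.mul_sum]
    refine Finset.sum_le_sum fun j hj => ?_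
    have hjk : j < k := Finset.mem_Iio.1 hj
    have h1 := ih j hjk (fun l hl => heq l (hl.trans hjk.le))
    have h2 : |(A (p k) j : ℝ)| ≤ 2 * T j := by exact_mod_cast hA.box (p k) j
    rw [abs_mul]
    calc |(A (p k) j : ℝ)| * |γ j - γ' j| ≤ (2 * T j) * |γ j - γ' j| := by gcongr
      _ = 2 * (T j * |γ j - γ' j|) := by ring
      _ ≤ 2 * (2 * C * 3 ^ (j : ℕ) * M) := by gcongr
      _ = _ := by ring
  have h4 : (T k : ℝ) * |γ k - γ' k| = |((T k : ℤ) : ℝ) * (γ k - γ' k)| := by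
    rw [abs_mul]; simp
  rw [h4]
  have h5 := abs_add_le (∑ j ∈ Finset.Iio k, (A (p k) j : ℝ) * (γ j - γ' j) +
    ((T k : ℤ) : ℝ) * (γ k - γ' k)) (-∑ j ∈ Finset.Iio k, (A (p k) j : ℝ) * (γ j - γ' j))
  rw [abs_neg, add_neg_cancel_comm] at h5
  linarith

/-- The width, in units of `M`, of a common spherical shell that contains the rows of all admissible
matrices with the same pivot rows. -/
def admissibleConst (d : ℕ) (C : ℝ) : ℝ := C + 3 + 4 * (d + 1) * C * 3 ^ (d + 1)

/-- Replacing the diameter of the sphere by a nearby one costs only a bounded multiple of `M` in the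
sphere equation. -/
theorem abs_sum_le_of_center_stable {d M : ℕ} {C : ℝ} (hC : 0 ≤ C)
    (T : Fin (d + 1) → ℕ) (γ γ' : Fin (d + 1) → ℝ) (J : Finset (Fin (d + 1)))
    (hst : ∀ k ∈ J, (T k : ℝ) * |γ k - γ' k| ≤ 2 * C * 3 ^ (k : ℕ) * M)
    (a : Fin (d + 1) → ℤ) (ha : ∀ j, |a j| ≤ 2 * (T j : ℤ)) :
    |∑ j ∈ J, (a j : ℝ) * (a j - γ j)| ≤ |∑ j ∈ J, (a j : ℝ) * (a j - γ' j)| +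
      4 * (d + 1) * C * 3 ^ (d + 1) * M := by
  have h1 : ∑ j ∈ J, (a j : ℝ) * (a j - γ j) =
      ∑ j ∈ J, (a j : ℝ) * (a j - γ' j) + ∑ j ∈ J, -((a j : ℝ) * (γ j - γ' j)) := by
    rw [← Finset.sum_add_distrib]
    exact Finset.sum_congr rfl fun j _ => by ring
  rw [h1]
  refine (abs_add_le _ _).trans (add_le_add_right ?_ _)
  have h2 : ∀ j ∈ J, |-((a j : ℝ) * (γ j - γ' j))| ≤ 4 * C * 3 ^ (d + 1) * M := by
    intro j hj
    have h3 : |(a j : ℝ)| ≤ 2 * T j := by exact_mod_cast ha j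
    rw [abs_neg, abs_mul]
    calc |(a j : ℝ)| * |γ j - γ' j| ≤ (2 * T j) * |γ j - γ' j| := by gcongr
      _ = 2 * (T j * |γ j - γ' j|) := by ring
      _ ≤ 2 * (2 * C * 3 ^ (j : ℕ) * M) := mul_le_mul_of_nonneg_left (hst j hj) two_pos.le
      _ ≤ 2 * (2 * C * 3 ^ (d + 1) * M) := by
        gcongr
        · norm_num
        · exact j.2.le
      _ = _ := by ring
  calc _ ≤ ∑ j ∈ J, |-((a j : ℝ) * (γ j - γ' j))| := Finset.abs_sum_le_sum_abs _ _
    _ ≤ J.card • (4 * C * 3 ^ (d + 1) * M) := Finset.sum_le_card_nsmul _ _ _ h2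
    _ ≤ ((d + 1 : ℕ) : ℝ) * (4 * C * 3 ^ (d + 1) * M) := by
      rw [nsmul_eq_mul]
      gcongr
      simpa using Finset.card_le_univ J
    _ = _ := by push_cast; ring

/-- The number of admissible matrices with prescribed pivots. The rows are counted by rank, pivot rows
in their order before all others. The `k`-th pivot row contributes
`(T k / M) * ∏ j < k, T j`, because its truncation to the first `k` coordinates satisfies the sphere
equation only up to `O(T k * M)`; each other row contributes `(1 / M) * ∏ j, T j`. -/
theorem admissible_card_le {m d : ℕ} {C : ℝ} (hC : 0 ≤ C) {M : ℕ} (hM : 0 < M)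
    {p : Fin (d + 1) → Fin m} (hp : Function.Injective p) {T : Fin (d + 1) → ℕ}
    (hT : ∀ j, 1 ≤ T j) (hTM : ∀ j, T j ≤ M) (hT₀ : T 0 = M)
    (S : Finset (Fin m → Fin (d + 1) → ℤ)) (hS : ∀ A ∈ S, Admissible C M p T A) :
    (S.card : ℝ) ≤ (slabConst (d + 1) * admissibleConst d C) ^ m *
      ((∏ j, (T j : ℝ) ^ (m - (j : ℕ))) / M ^ m) := by
  classical
  have hMR : (0 : ℝ) < M := by exact_mod_cast hM
  set D := admissibleConst d C with hD
  have hD1 : 1 ≤ D := by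
    have : 0 ≤ 4 * ((d : ℝ) + 1) * C * 3 ^ (d + 1) := by positivity
    rw [hD]; unfold admissibleConst; linarith
  set K := slabConst (d + 1) with hK
  have hK1 : 1 ≤ K := by
    have h1 : (1 : ℝ) ≤ ((d + 1 : ℕ) : ℝ) ^ 3 := one_le_pow₀ (by norm_cast; omega)
    have h2 : (1 : ℝ) ≤ 5 ^ (d + 1) := one_le_pow₀ (by norm_num)
    rw [hK]; unfold slabConst; nlinarith
  -- The pivot row `p k` has rank `k`, all other rows have the common rank `d + 1`.
  let rk : Fin m → ℕ := fun i => if h : ∃ k, p k = i then (h.choose : ℕ) else d + 1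
  have hrkp : ∀ k, rk (p k) = k := by
    intro k
    have h : ∃ l, p l = p k := ⟨k, rfl⟩
    simp only [rk, dif_pos h]
    rw [hp h.choose_spec]
  have hrkn : ∀ i, (¬ ∃ k, p k = i) → rk i = d + 1 := fun i h => by simp only [rk, dif_neg h]
  let B : Fin m → ℝ := fun i => if h : ∃ k, p k = i then
    K * D * (T h.choose / M) * ∏ j ∈ Finset.Iio h.choose, (T j : ℝ) else K * D / M * ∏ j, (T j : ℝ)
  have hBp : ∀ k, B (p k) = K * D * (T k / M) * ∏ j ∈ Finset.Iio k, (T j : ℝ) := by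
    intro k
    have h : ∃ l, p l = p k := ⟨k, rfl⟩
    simp only [B, dif_pos h]
    rw [hp h.choose_spec]
  have hBn : ∀ i, (¬ ∃ k, p k = i) → B i = K * D / M * ∏ j, (T j : ℝ) := fun i h => by
    simp only [B, dif_neg h]
  have hB0 : ∀ i, 0 ≤ B i := by
    intro i
    by_cases h : ∃ k, p k = i
    · obtain ⟨k, rfl⟩ := h
      rw [hBp]
      positivity
    · rw [hBn i h]
      positivity
  have hcard := card_le_prod_of_rank S rk B hB0 (by
    intro A hA i Y hY
    have hadA := hS A hA
    obtain ⟨γ, hγb, hγ0, hγ⟩ := hadA.center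
    by_cases h : ∃ k, p k = i
    · obtain ⟨k, rfl⟩ := h
      rw [hBp]
      rw [hrkp] at hY
      -- The first pivot row is `(M, 0, …, 0)`, the factor `T 0 / M = 1` is then harmless.
      by_cases hk0 : k = 0
      · subst hk0
        have hz : Finset.Iio (0 : Fin (d + 1)) = ∅ := by ext x; simp
        rw [hz, Finset.prod_empty, hT₀, div_self hMR.ne']
        refine le_trans (b := (1 : ℝ)) ?_ (by nlinarith)
        have hone : Y.card ≤ 1 := by
          rw [Finset.card_le_one]
          intro x hx y hy
          obtain ⟨b, hb, hb2, rfl⟩ := hY _ hx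
          obtain ⟨c, hc, -, rfl⟩ := hY _ hy
          have hb' := hS b hb
          have hc' := hS c hc
          funext j
          rcases eq_or_ne j 0 with rfl | hj
          · rw [hb'.diag, hc'.diag]
          · rw [hb'.upper 0 j (Fin.pos_of_ne_zero hj), hc'.upper 0 j (Fin.pos_of_ne_zero hj)]
        exact_mod_cast hone
      · have hk0' : 0 < k := Fin.pos_of_ne_zero hk0
        have hTk : (1 : ℝ) ≤ T k := by exact_mod_cast hT k
        refine (slab_card_le (Finset.Iio k) (i₀ := 0) (by simpa using hk0') hM T
          (fun j _ => hT j) hT₀ γ (fun j _ => hγb j) (by rw [hγ0]; simp; positivity)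
          (E := D * T k * M) ?_ _ ?_ ?_ ?_).trans ?_
        · nlinarith [mul_le_mul hD1 hTk zero_le_one (by linarith)]
        · intro a ha j _
          obtain ⟨b, hb, hb2, rfl⟩ := hY _ ha
          exact (hS b hb).box _ _
        · intro x hx y hy j hj
          obtain ⟨b, hb, hb2, rfl⟩ := hY _ hx
          obtain ⟨c, hc, -, rfl⟩ := hY _ hy
          have hb' := hS b hb
          have hc' := hS c hc
          rcases (show k ≤ j by simpa using hj).eq_or_lt with rfl | hj
          · rw [hb'.diag, hc'.diag]
          · rw [hb'.upper k j hj, hc'.upper k j hj]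
        · intro a ha
          obtain ⟨b, hb, hb2, rfl⟩ := hY _ ha
          have hb' := hS b hb
          obtain ⟨γ', hγb', hγ0', hγ'⟩ := hb'.center
          have hst : ∀ l ∈ Finset.Iio k, (T l : ℝ) * |γ l - γ' l| ≤ 2 * C * 3 ^ (l : ℕ) * M := by
            intro l hl
            refine center_stable hadA hγ hγ' l fun l' hl' => hb2 _ ?_
            rw [hrkp]
            exact Fin.lt_def.1 (lt_of_le_of_lt hl' (Finset.mem_Iio.1 hl))
          refine (abs_sum_le_of_center_stable hC T γ γ' _ hst _ (hb'.box _)).trans ?_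
          have h1 := hγ' (p k)
          rw [sum_eq_sum_Iio_add k _ (fun j hj => by rw [hb'.upper k j hj]; simp),
            hb'.diag k] at h1
          -- The diagonal term `T k * (T k - γ' k)` is the price of truncating to the first `k` coordinates.
          have h2 : |((T k : ℤ) : ℝ) * ((T k : ℤ) - γ' k)| ≤ 3 * T k * M := by
            rw [abs_mul]
            have h3 := abs_sub ((T k : ℤ) : ℝ) (γ' k)
            have h4 := hγb' k
            have h5 : (T k : ℝ) ≤ M := by exact_mod_cast hTM k
            have h6 : |((T k : ℤ) : ℝ)| = T k := by simp
            rw [h6] at h3 ⊢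
            nlinarith
          have h3 := abs_add_le (∑ j ∈ Finset.Iio k, (b (p k) j : ℝ) * (b (p k) j - γ' j) +
            ((T k : ℤ) : ℝ) * ((T k : ℤ) - γ' k)) (-(((T k : ℤ) : ℝ) * ((T k : ℤ) - γ' k)))
          rw [abs_neg, add_neg_cancel_right] at h3
          have h4 : 0 ≤ C * M := by positivity
          have h5 : 0 ≤ 4 * ((d : ℝ) + 1) * C * 3 ^ (d + 1) * M := by positivity
          have h6 : D * T k * M = T k * (C * M) + 3 * T k * M +
              T k * (4 * ((d : ℝ) + 1) * C * 3 ^ (d + 1) * M) := by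
            rw [hD]; unfold admissibleConst; ring
          rw [h6]
          nlinarith
        · rw [Fintype.card_fin]
          refine mul_le_mul_of_nonneg_right (le_of_eq ?_) (by positivity)
          field_simp
          exact hK.symm
    · rw [hBn i h]
      rw [hrkn i h] at hY
      refine (slab_card_le Finset.univ (i₀ := 0) (Finset.mem_univ _) hM T
          (fun j _ => hT j) hT₀ γ (fun j _ => hγb j) (by rw [hγ0]; simp; positivity)
          (E := D * M) ?_ _ ?_ ?_ ?_).trans ?_
      · nlinarith
      · intro a ha j _
        obtain ⟨b, hb, hb2, rfl⟩ := hY _ ha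
        exact (hS b hb).box _ _
      · intro x hx y hy j hj
        exact absurd (Finset.mem_univ j) hj
      · intro a ha
        obtain ⟨b, hb, hb2, rfl⟩ := hY _ ha
        have hb' := hS b hb
        obtain ⟨γ', hγb', hγ0', hγ'⟩ := hb'.center
        have hst : ∀ l ∈ Finset.univ, (T l : ℝ) * |γ l - γ' l| ≤ 2 * C * 3 ^ (l : ℕ) * M := by
          intro l _
          refine center_stable hadA hγ hγ' l fun l' hl' => hb2 _ ?_
          rw [hrkp]
          exact l'.2
        refine (abs_sum_le_of_center_stable hC T γ γ' _ hst _ (hb'.box _)).trans ?_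
        have h1 := hγ' i
        rw [hD]; unfold admissibleConst
        nlinarith
      · rw [Fintype.card_fin]
        refine mul_le_mul_of_nonneg_right (le_of_eq ?_) (by positivity)
        field_simp
        exact hK.symm)
  refine hcard.trans (le_of_eq ?_)
  have hprod : ∏ i, B i = (∏ k, B (p k)) * ∏ i ∈ (Finset.univ.image p)ᶜ, B i := by
    rw [← Finset.prod_mul_prod_compl (Finset.univ.image p), Finset.prod_image fun x _ y _ h => hp h]
  have hcompl : ((Finset.univ.image p)ᶜ).card = m - (d + 1) := by
    rw [Finset.card_compl, Finset.card_image_of_injective _ hp]; simp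
  have hdm : d + 1 ≤ m := by simpa using Fintype.card_le_of_injective p hp
  have hN : ∏ i ∈ (Finset.univ.image p)ᶜ, B i =
      (K * D / M * ∏ j, (T j : ℝ)) ^ (m - (d + 1)) := by
    rw [← hcompl, ← Finset.prod_const]
    refine Finset.prod_congr rfl fun i hi => hBn i ?_
    simpa using hi
  have hPk : ∏ k, B (p k) = (K * D / M) ^ (d + 1) * ((∏ j, (T j : ℝ)) *
      ∏ j : Fin (d + 1), (T j : ℝ) ^ (d - (j : ℕ))) := by
    have h1 : ∏ k : Fin (d + 1), ∏ j ∈ Finset.Iio k, (T j : ℝ) =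
        ∏ j : Fin (d + 1), (T j : ℝ) ^ (d - (j : ℕ)) := by
      rw [Finset.prod_comm' (s' := fun j => Finset.Ioi j) (t' := Finset.univ)]
      · refine Finset.prod_congr rfl fun j _ => ?_
        rw [Finset.prod_const, Fin.card_Ioi]
        rfl
      · simp
    rw [← h1, ← Finset.prod_mul_distrib, ← Fin.prod_const, ← Finset.prod_mul_distrib]
    refine Finset.prod_congr rfl fun k _ => ?_
    rw [hBp]
    ring
  rw [hprod, hN, hPk, mul_pow _ (∏ j, (T j : ℝ))]
  have h2 : ∏ j : Fin (d + 1), (T j : ℝ) ^ (m - (j : ℕ)) =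
      (∏ j, (T j : ℝ)) * (∏ j : Fin (d + 1), (T j : ℝ) ^ (d - (j : ℕ))) *
        (∏ j, (T j : ℝ)) ^ (m - (d + 1)) := by
    rw [← Finset.prod_pow, ← Finset.prod_mul_distrib, ← Finset.prod_mul_distrib]
    refine Finset.prod_congr rfl fun j _ => ?_
    rw [← pow_succ', ← pow_add]
    congr 1
    have := j.2
    omega
  rw [h2, ← Nat.add_sub_cancel' hdm, Nat.add_sub_cancel_left]
  generalize ∏ j, (T j : ℝ) = X
  generalize ∏ j : Fin (d + 1), (T j : ℝ) ^ (d - (j : ℕ)) = Y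
  rw [pow_add (K * D), pow_add (M : ℝ), div_pow, div_pow]
  field_simp

/-! ### Pivoted Gram-Schmidt -/

section pivot
variable {E ι : Type*} [NormedAddCommGroup E] [InnerProductSpace ℝ E]

open scoped InnerProductSpace

/-- `e` is an orthonormal family obtained from the vectors `u` by Gram-Schmidt with pivoting, where
`p j` is the index of the `j`-th pivot: the pivot `⟪e j, u (p j)⟫` exceeds `η` and dominates the
`j`-th coordinate of every vector, and `u (p k)` lies in the span of `e 0, …, e k`. The first pivot is
a unit vector and is itself the first member of the family. -/
structure IsPivotFrame (u : ι → E) (η : ℝ) {d : ℕ} (p : Fin (d + 1) → ι) (e : Fin (d + 1) → E) :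
    Prop where
  orthonormal : Orthonormal ℝ e
  first : e 0 = u (p 0)
  dominated : ∀ i j, |⟪e j, u i⟫_ℝ| ≤ ⟪e j, u (p j)⟫_ℝ
  large : ∀ j, η < ⟪e j, u (p j)⟫_ℝ
  upper : ∀ k j, k < j → ⟪e j, u (p k)⟫_ℝ = 0
  mem_span : ∀ k, u (p k) = ∑ j, ⟪e j, u (p k)⟫_ℝ • e j

theorem IsPivotFrame.injective {u : ι → E} {η : ℝ} (hη : 0 ≤ η) {d : ℕ} {p : Fin (d + 1) → ι}
    {e : Fin (d + 1) → E} (h : IsPivotFrame u η p e) : Function.Injective p := by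
  intro k j hkj
  by_contra hne
  rcases lt_or_gt_of_ne hne with hlt | hlt
  · have h1 := h.upper k j hlt
    have h2 := h.large j
    rw [← hkj] at h2
    linarith
  · have h1 := h.upper j k hlt
    have h2 := h.large k
    rw [hkj] at h2
    linarith

/-- As long as some residual exceeds `η`, the normalized largest residual extends the frame. -/
theorem IsPivotFrame.exists_extend [Fintype ι] {u : ι → E} {η : ℝ} (hη : 0 ≤ η) {d : ℕ}
    {p : Fin (d + 1) → ι} {e : Fin (d + 1) → E} (h : IsPivotFrame u η p e)
    (hres : ∃ i, η < ‖u i - ∑ j, ⟪e j, u i⟫_ℝ • e j‖) :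
    ∃ (p' : Fin (d + 1 + 1) → ι) (e' : Fin (d + 1 + 1) → E), IsPivotFrame u η p' e' := by
  obtain ⟨i₀, hi₀⟩ := hres
  have : Nonempty ι := ⟨i₀⟩
  set w : ι → E := fun i => u i - ∑ j, ⟪e j, u i⟫_ℝ • e j with hw
  obtain ⟨i, hi⟩ := Finite.exists_max fun i => ‖w i‖
  have hwi : η < ‖w i‖ := hi₀.trans_le (hi i₀)
  have hwpos : 0 < ‖w i‖ := hη.trans_lt hwi
  have horth : ∀ j l, ⟪e j, w l⟫_ℝ = 0 := by
    intro j l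
    simp only [hw, inner_sub_right]
    rw [h.orthonormal.inner_right_fintype, sub_self]
  set f : E := ‖w i‖⁻¹ • w i with hf
  have hfn : ‖f‖ = 1 := by
    rw [hf, norm_smul, norm_inv, norm_norm, inv_mul_cancel₀ hwpos.ne']
  have hef : ∀ j, ⟪e j, f⟫_ℝ = 0 := fun j => by rw [hf, inner_smul_right, horth, mul_zero]
  have hfu : ∀ l, ⟪f, u l⟫_ℝ = ⟪f, w l⟫_ℝ := by
    intro l
    simp only [hw, inner_sub_right, inner_sum, inner_smul_right]
    have : ∀ j, ⟪f, e j⟫_ℝ = 0 := fun j => by rw [real_inner_comm]; exact hef j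
    simp [this]
  have hfi : ⟪f, u i⟫_ℝ = ‖w i‖ := by
    rw [hfu, hf, real_inner_smul_left, real_inner_self_eq_norm_sq]
    field_simp
  have hfp : ∀ k, ⟪f, u (p k)⟫_ℝ = 0 := by
    intro k
    have : w (p k) = 0 := sub_eq_zero.2 (h.mem_span k)
    rw [hfu, this, inner_zero_right]
  refine ⟨Fin.snoc p i, Fin.snoc e f, ?_, ?_, ?_, ?_, ?_, ?_⟩
  · rw [orthonormal_iff_ite]
    have h0 := orthonormal_iff_ite.1 h.orthonormal
    intro a b
    refine Fin.lastCases ?_ (fun a => ?_) a <;> refine Fin.lastCases ?_ (fun b => ?_) b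
    · simp [hfn]
    · have : Fin.last (d + 1) ≠ b.castSucc := (Fin.castSucc_lt_last b).ne'
      simp only [Fin.snoc_last, Fin.snoc_castSucc, this, if_false]
      rw [real_inner_comm]; exact hef b
    · have : a.castSucc ≠ Fin.last (d + 1) := (Fin.castSucc_lt_last a).ne
      simp only [Fin.snoc_last, Fin.snoc_castSucc, this, if_false]
      exact hef a
    · simp [h0 a b]
  · have := h.first
    rw [← Fin.castSucc_zero, Fin.snoc_castSucc, Fin.snoc_castSucc]
    exact this
  · intro l j
    refine Fin.lastCases ?_ (fun j => ?_) j
    · simp only [Fin.snoc_last]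
      rw [hfi, hfu]
      refine (abs_real_inner_le_norm _ _).trans ?_
      rw [hfn, one_mul]
      exact hi l
    · simpa using h.dominated l j
  · intro j
    refine Fin.lastCases ?_ (fun j => ?_) j
    · simp only [Fin.snoc_last]
      rwa [hfi]
    · simpa using h.large j
  · intro k j
    refine Fin.lastCases ?_ (fun k => ?_) k <;> refine Fin.lastCases ?_ (fun j => ?_) j
    · intro hlt; exact absurd hlt (lt_irrefl _)
    · intro hlt; exact absurd hlt (not_lt.2 (Fin.le_last _))
    · intro _
      simpa using hfp k
    · intro hlt
      simpa using h.upper k j (by simpa using hlt)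
  · intro k
    rw [Fin.sum_univ_castSucc]
    refine Fin.lastCases ?_ (fun k => ?_) k
    · simp only [Fin.snoc_last, Fin.snoc_castSucc]
      rw [hfi, hf, smul_smul, mul_inv_cancel₀ hwpos.ne', one_smul]
      simp only [hw]
      abel
    · simp only [Fin.snoc_last, Fin.snoc_castSucc]
      rw [hfp, zero_smul, add_zero]
      exact h.mem_span k

theorem exists_pivotFrame [Fintype ι] {u : ι → E} {η : ℝ} (hη : 0 ≤ η) (hη1 : η < 1)
    (hu : ∀ i, ‖u i‖ ≤ 1) (hu1 : ∃ i, ‖u i‖ = 1) :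
    ∃ (d : ℕ) (p : Fin (d + 1) → ι) (e : Fin (d + 1) → E), IsPivotFrame u η p e ∧
      ∀ i, ‖u i - ∑ j, ⟪e j, u i⟫_ℝ • e j‖ ≤ η := by
  by_contra! hcon
  have hall : ∀ d : ℕ, ∃ (p : Fin (d + 1) → ι) (e : Fin (d + 1) → E), IsPivotFrame u η p e := by
    intro d
    induction d with
    | zero =>
      have hsub : Subsingleton (Fin (0 + 1)) := inferInstanceAs (Subsingleton (Fin 1))
      obtain ⟨i, hi⟩ := hu1
      have hii : ⟪u i, u i⟫_ℝ = 1 := by rw [real_inner_self_eq_norm_sq, hi, one_pow]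
      refine ⟨fun _ => i, fun _ => u i, ?_, rfl, ?_, ?_, ?_, ?_⟩
      · rw [orthonormal_iff_ite]
        intro a b
        simp [Subsingleton.elim a b, hi]
      · intro l j
        rw [hii]
        refine (abs_real_inner_le_norm _ _).trans ?_
        rw [hi, one_mul]
        exact hu l
      · intro j; rwa [hii]
      · intro k j hkj
        exact absurd hkj (by rw [Subsingleton.elim k j]; exact lt_irrefl _)
      · intro k
        simp [hi]
    | succ d ih =>
      obtain ⟨p, e, h⟩ := ih
      exact h.exists_extend hη (hcon d p e h)
  -- Pivots are distinct, so a frame cannot have more members than there are vectors.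
  obtain ⟨p, e, h⟩ := hall (Fintype.card ι)
  have := Fintype.card_le_of_injective p (h.injective hη)
  simp at this

end pivot

/-! ### Rounding a configuration on a sphere -/

open scoped InnerProductSpace

/-- Rounding the coordinates of vectors `u i` on a common sphere, multiplied by `M`, with respect to a
pivot frame of threshold `1 / M` gives an admissible matrix. A linear combination of the vectors
that is small remains so for the columns of the matrix, up to the rounding error `m * L`. -/
theorem exists_admissible_of_sphere {E : Type*} [NormedAddCommGroup E] [InnerProductSpace ℝ E]
    {m : ℕ} {u : Fin m → E} {c : E} (hu : ∀ i, ‖u i‖ ≤ 1) (hu1 : ∃ i, ‖u i‖ = 1) (hc : ‖c‖ ≤ 2)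
    (huc : ∀ i, ⟪u i, u i⟫_ℝ = ⟪u i, c⟫_ℝ) {M : ℕ} (hM : 2 ≤ M) :
    ∃ (d : ℕ) (p : Fin (d + 1) → Fin m) (T : Fin (d + 1) → ℕ) (A : Fin m → Fin (d + 1) → ℤ),
      Function.Injective p ∧ (∀ j, 1 ≤ T j) ∧ (∀ j, T j ≤ M) ∧ T 0 = M ∧
      Admissible (3 * (m + 1)) M p T A ∧
      ∀ (w : Fin m → ℝ) (L ε : ℝ), (∀ i, |w i| ≤ L) → ‖∑ i, w i • u i‖ ≤ ε →
        ∀ j, |∑ i, w i * A i j| ≤ M * ε + m * L := by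
  have hMR : (2 : ℝ) ≤ M := by exact_mod_cast hM
  have hMpos : (0 : ℝ) < M := by linarith
  obtain ⟨d, p, e, hF, hres⟩ := exists_pivotFrame (u := u) (η := 1 / (M : ℝ)) (by positivity)
    ((div_lt_one hMpos).2 (by linarith)) hu hu1
  have hinj := hF.injective (by positivity)
  have hdm : d + 1 ≤ m := by simpa using Fintype.card_le_of_injective p hinj
  set x : Fin m → Fin (d + 1) → ℝ := fun i j => ⟪e j, u i⟫_ℝ with hx
  set A : Fin m → Fin (d + 1) → ℤ := fun i j => round (M * x i j) with hA
  have hround : ∀ i j, |(A i j : ℝ) - M * x i j| ≤ 1 / 2 := fun i j => by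
    rw [abs_sub_comm]; exact abs_sub_round _
  have hxle : ∀ i j, |x i j| ≤ 1 := fun i j => by
    refine (abs_real_inner_le_norm _ _).trans ?_
    rw [hF.orthonormal.1 j, one_mul]
    exact hu i
  have hMx : ∀ i j, |M * x i j| ≤ M := fun i j => by
    rw [abs_mul, abs_of_pos hMpos]
    exact mul_le_of_le_one_right hMpos.le (hxle i j)
  have hlarge : ∀ j, 1 < M * x (p j) j := fun j => by
    have := hF.large j
    rw [div_lt_iff₀ hMpos] at this
    simp only [hx]; linarith
  have hAp : ∀ j, 1 ≤ A (p j) j := by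
    intro j
    have h1 := (abs_le.1 (hround (p j) j)).1
    have h2 : (0 : ℝ) < A (p j) j := by linarith [hlarge j]
    have h3 : 0 < A (p j) j := by exact_mod_cast h2
    omega
  have hAM : ∀ j, A (p j) j ≤ M := by
    intro j
    have h1 := (abs_le.1 (hround (p j) j)).2
    have h2 := (abs_le.1 (hMx (p j) j)).2
    have h3 : (A (p j) j : ℝ) < (M : ℤ) + 1 := by push_cast; linarith
    have h4 : A (p j) j < (M : ℤ) + 1 := by exact_mod_cast h3
    omega
  have hT : ∀ j, ((A (p j) j).toNat : ℤ) = A (p j) j := fun j =>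
    Int.toNat_of_nonneg (by linarith [hAp j])
  have hp0 : ‖u (p 0)‖ = 1 := by rw [← hF.first]; exact hF.orthonormal.1 0
  have hA0 : A (p 0) 0 = M := by
    have : x (p 0) 0 = 1 := by
      simp only [hx]
      rw [hF.first, real_inner_self_eq_norm_sq, hp0, one_pow]
    simp only [hA]
    rw [this, mul_one]
    exact round_natCast M
  refine ⟨d, p, fun j => (A (p j) j).toNat, A, hinj, fun j => ?_, fun j => ?_, ?_,
    ⟨fun i j => ?_, fun k => (hT k).symm, fun k j hkj => ?_, ?_⟩, ?_⟩
  · have h1 := hAp j; have h2 := hT j; dsimp only; omega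
  · have h1 := hAM j; have h2 := hT j; dsimp only; omega
  · simp only [hA0]; exact Int.toNat_natCast M
  · rw [hT]
    have h1 := hF.dominated i j
    have h2 : |M * x i j| ≤ M * x (p j) j := by
      rw [abs_mul, abs_of_pos hMpos]
      exact mul_le_mul_of_nonneg_left h1 hMpos.le
    have h3 := abs_le.1 (hround (p j) j)
    have h4 : |(A i j : ℝ)| ≤ |M * x i j| + 1 / 2 := by
      have := abs_sub_abs_le_abs_sub (A i j : ℝ) (M * x i j)
      linarith [hround i j]
    have h5 : |(A i j : ℝ)| ≤ 2 * (A (p j) j : ℝ) := by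
      have : (1 : ℝ) ≤ A (p j) j := by exact_mod_cast hAp j
      linarith [h3.1]
    exact_mod_cast h5
  · have : x (p k) j = 0 := hF.upper k j hkj
    simp only [hA]
    rw [this, mul_zero, round_zero]
  · refine ⟨fun j => M * ⟪e j, c⟫_ℝ, fun j => ?_, ?_, fun i => ?_⟩
    · rw [abs_mul, abs_of_pos hMpos]
      have h1 : |⟪e j, c⟫_ℝ| ≤ 2 := by
        refine (abs_real_inner_le_norm _ _).trans ?_
        rw [hF.orthonormal.1 j, one_mul]
        exact hc
      nlinarith
    -- The first pivot has norm one and lies on the sphere, which fixes the first coordinate of `c`.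
    · have : ⟪e 0, c⟫_ℝ = 1 := by
        rw [hF.first, ← huc, real_inner_self_eq_norm_sq, hp0, one_pow]
      simp only [this, mul_one]
    · set g : E := u i - ∑ j, ⟪e j, u i⟫_ℝ • e j with hg
      have hg1 : ‖g‖ ≤ 1 / M := hres i
      have hdec : u i = ∑ j, x i j • e j + g := by rw [hg]; abel
      have hge : ∀ j, ⟪e j, g⟫_ℝ = 0 := by
        intro j
        simp only [hg, inner_sub_right]
        rw [hF.orthonormal.inner_right_fintype, sub_self]
      have h1 : ⟪u i, u i⟫_ℝ = ∑ j, x i j * x i j + ⟪g, g⟫_ℝ := by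
        have h2 : ⟪g, u i⟫_ℝ = ⟪g, g⟫_ℝ := by
          conv_lhs => rw [hdec]
          rw [inner_add_right, inner_sum]
          have : ∀ j, ⟪g, x i j • e j⟫_ℝ = 0 := fun j => by
            rw [inner_smul_right, real_inner_comm, hge, mul_zero]
          simp [this]
        conv_lhs => rw [hdec, inner_add_left, sum_inner, ← hdec]
        rw [h2]
        simp only [real_inner_smul_left]
        rfl
      have h3 : ⟪u i, c⟫_ℝ = ∑ j, x i j * ⟪e j, c⟫_ℝ + ⟪g, c⟫_ℝ := by
        conv_lhs => rw [hdec, inner_add_left, sum_inner]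
        simp only [real_inner_smul_left]
      have h4 : ∑ j, M * x i j * (M * x i j - M * ⟪e j, c⟫_ℝ) =
          (M : ℝ) ^ 2 * (⟪g, c⟫_ℝ - ⟪g, g⟫_ℝ) := by
        have h5 : ⟪g, c⟫_ℝ - ⟪g, g⟫_ℝ = ∑ j, (x i j * x i j - x i j * ⟪e j, c⟫_ℝ) := by
          rw [Finset.sum_sub_distrib]
          linarith [huc i]
        rw [h5, Finset.mul_sum]
        exact Finset.sum_congr rfl fun j _ => by ring
      have h6 : |⟪g, c⟫_ℝ - ⟪g, g⟫_ℝ| ≤ 3 / M := by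
        have h7 := abs_real_inner_le_norm g c
        have h8 := abs_real_inner_le_norm g g
        have h9 : (1 : ℝ) / M ≤ 1 := (div_le_one hMpos).2 (by linarith)
        have h10 : ‖g‖ * ‖c‖ ≤ (1 / M) * 2 := by gcongr
        have h11 : ‖g‖ * ‖g‖ ≤ (1 / M) * 1 := by gcongr; linarith
        refine (abs_sub _ _).trans ?_
        have : (3 : ℝ) / M = 1 / M * 2 + 1 / M * 1 := by ring
        linarith
      have h7 : |∑ j, M * x i j * (M * x i j - M * ⟪e j, c⟫_ℝ)| ≤ 3 * M := by
        rw [h4, abs_mul, abs_of_pos (by positivity : (0 : ℝ) < (M : ℝ) ^ 2)]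
        calc (M : ℝ) ^ 2 * |⟪g, c⟫_ℝ - ⟪g, g⟫_ℝ| ≤ (M : ℝ) ^ 2 * (3 / (M : ℝ)) := by gcongr
          _ = 3 * (M : ℝ) := by field_simp
      have h8 : |∑ j, ((A i j : ℝ) * (A i j - M * ⟪e j, c⟫_ℝ) -
          M * x i j * (M * x i j - M * ⟪e j, c⟫_ℝ))| ≤ 3 * m * M := by
        refine (Finset.abs_sum_le_sum_abs _ _).trans ?_
        have : ∀ j ∈ Finset.univ, |(A i j : ℝ) * (A i j - M * ⟪e j, c⟫_ℝ) -
          M * x i j * (M * x i j - M * ⟪e j, c⟫_ℝ)| ≤ 3 * M := by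
          intro j _
          have hcj : |⟪e j, c⟫_ℝ| ≤ 2 := by
            refine (abs_real_inner_le_norm _ _).trans ?_
            rw [hF.orthonormal.1 j, one_mul]
            exact hc
          have hcM : |M * ⟪e j, c⟫_ℝ| ≤ 2 * M := by
            rw [abs_mul, abs_of_pos hMpos]
            nlinarith
          rw [show (A i j : ℝ) * (A i j - M * ⟪e j, c⟫_ℝ) -
            M * x i j * (M * x i j - M * ⟪e j, c⟫_ℝ) =
            ((A i j : ℝ) - M * x i j) * (A i j + M * x i j - M * ⟪e j, c⟫_ℝ) by ring, abs_mul]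
          have h9 := hround i j
          have h10 : |(A i j : ℝ) + M * x i j - M * ⟪e j, c⟫_ℝ| ≤ 6 * M := by
            have h11 := hMx i j
            rw [abs_le] at h9 h11 hcM ⊢
            constructor <;> linarith [h9.1, h9.2, h11.1, h11.2, hcM.1, hcM.2]
          calc _ ≤ 1 / 2 * (6 * (M : ℝ)) := by gcongr
            _ = 3 * M := by ring
        refine (Finset.sum_le_card_nsmul _ _ _ this).trans ?_
        rw [nsmul_eq_mul, Finset.card_univ, Fintype.card_fin]
        have : ((d + 1 : ℕ) : ℝ) ≤ m := by exact_mod_cast hdm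
        nlinarith
      rw [Finset.sum_sub_distrib] at h8
      rw [abs_le] at h7 h8 ⊢
      constructor <;> nlinarith [h7.1, h7.2, h8.1, h8.2]
  · intro w L ε hw hε j
    have h1 : ∑ i, w i * (A i j : ℝ) = M * ∑ i, w i * x i j +
        ∑ i, w i * ((A i j : ℝ) - M * x i j) := by
      rw [Finset.mul_sum, ← Finset.sum_add_distrib]
      exact Finset.sum_congr rfl fun i _ => by ring
    have h2 : ∑ i, w i * x i j = ⟪e j, ∑ i, w i • u i⟫_ℝ := by
      rw [inner_sum]
      simp only [inner_smul_right]
      rfl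
    have h3 : |∑ i, w i * x i j| ≤ ε := by
      rw [h2]
      refine (abs_real_inner_le_norm _ _).trans ?_
      rw [hF.orthonormal.1 j, one_mul]
      exact hε
    have h4 : |∑ i, w i * ((A i j : ℝ) - M * x i j)| ≤ m * L := by
      refine (Finset.abs_sum_le_sum_abs _ _).trans ?_
      have : ∀ i ∈ Finset.univ, |w i * ((A i j : ℝ) - M * x i j)| ≤ L := by
        intro i _
        have hL : 0 ≤ L := (abs_nonneg _).trans (hw i)
        rw [abs_mul]
        calc _ ≤ L * 1 := by
              gcongr
              · exact hw i
              · linarith [hround i j]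
          _ = L := mul_one L
      refine (Finset.sum_le_card_nsmul _ _ _ this).trans ?_
      simp
    rw [h1]
    refine (abs_add_le _ _).trans (add_le_add ?_ h4)
    rw [abs_mul, abs_of_pos hMpos]
    gcongr

/-! ### Vectors attached to an optimal point of the relaxation -/

/-- The coefficients of the row `a` of `[H, -y]`, so that the cost matrix is a sum of rank one matrices
over the rows. -/
def costRow {n m : ℕ} (H : Matrix (Fin n) (Fin m) ℝ) (y : Fin n → ℝ) (a : Fin n) :
    Fin m ⊕ Unit → ℝ :=
  Sum.elim (H a) fun _ => -y a

theorem costMatrix_apply {n m : ℕ} (H : Matrix (Fin n) (Fin m) ℝ) (y : Fin n → ℝ)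
    (k l : Fin m ⊕ Unit) : costMatrix H y k l = ∑ a, costRow H y a k * costRow H y a l := by
  rcases k with k | k <;> rcases l with l | l <;>
    simp [costMatrix, costRow, Matrix.mul_apply]

theorem trace_costMatrix_mul {n m : ℕ} (H : Matrix (Fin n) (Fin m) ℝ) (y : Fin n → ℝ)
    (X : Matrix (Fin m ⊕ Unit) (Fin m ⊕ Unit) ℝ) :
    (costMatrix H y * X).trace =
      ∑ a, ∑ k, ∑ l, costRow H y a k * costRow H y a l * X l k := by
  rw [Finset.sum_comm]
  simp only [Matrix.trace, Matrix.diag_apply, Matrix.mul_apply]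
  refine Finset.sum_congr rfl fun k _ => ?_
  rw [Finset.sum_comm]
  refine Finset.sum_congr rfl fun l _ => ?_
  rw [costMatrix_apply, Finset.sum_mul]

theorem trace_costMatrix_mul_gram {n m : ℕ} (H : Matrix (Fin n) (Fin m) ℝ) (y : Fin n → ℝ)
    {E : Type*} [NormedAddCommGroup E] [InnerProductSpace ℝ E] (b : Fin m ⊕ Unit → E)
    (X : Matrix (Fin m ⊕ Unit) (Fin m ⊕ Unit) ℝ) (hX : ∀ k l, X k l = ⟪b k, b l⟫_ℝ) :
    (costMatrix H y * X).trace = ∑ a, ‖∑ k, costRow H y a k • b k‖ ^ 2 := by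
  rw [trace_costMatrix_mul]
  refine Finset.sum_congr rfl fun a _ => ?_
  rw [← real_inner_self_eq_norm_sq, sum_inner]
  refine Finset.sum_congr rfl fun k _ => ?_
  rw [inner_sum]
  refine Finset.sum_congr rfl fun l _ => ?_
  rw [real_inner_smul_left, inner_smul_right, hX, real_inner_comm]
  ring

theorem feasible_rankOne {m : ℕ} {s : Fin m → ℝ} (hs : s ∈ messages m) :
    (Matrix.of fun k l => (Sum.elim s fun _ => (1 : ℝ)) k * (Sum.elim s fun _ => (1 : ℝ)) l) ∈
      feasible m := by
  refine ⟨?_, ?_⟩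
  · have := Matrix.posSemidef_vecMulVec_self_star (Sum.elim s fun _ : Unit => (1 : ℝ))
    rw [star_trivial] at this
    exact this
  · rintro (i | i)
    · rcases hs i with h | h <;> simp [h]
    · simp

open scoped MatrixOrder in
theorem exists_conjTranspose_mul_self {ι : Type*} [Fintype ι] {X : Matrix ι ι ℝ}
    (hX : X.PosSemidef) : ∃ B : Matrix ι ι ℝ, X = Bᴴ * B := by
  classical
  exact CStarAlgebra.nonneg_iff_eq_star_mul_self.mp hX.nonneg

/-- An error of the detector produces vectors on a common sphere through the origin, normalized to
maximal length one, which every row of `H diag(s)` almost annihilates when the noise is small. -/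
theorem exists_sphere_of_error {n m : ℕ} {H : Matrix (Fin n) (Fin m) ℝ} {s : Fin m → ℝ}
    (hs : s ∈ messages m) {v : Fin n → ℝ} {X : Matrix (Fin m ⊕ Unit) (Fin m ⊕ Unit) ℝ}
    (hX : IsOptimal H (received H s v) X) (herr : rounded X ≠ s) {τ : ℝ} (hv : ∀ a, |v a| ≤ τ) :
    ∃ (u : Fin m → EuclideanSpace ℝ (Fin m ⊕ Unit)) (c : EuclideanSpace ℝ (Fin m ⊕ Unit)),
      (∀ i, ‖u i‖ ≤ 1) ∧ (∃ i, ‖u i‖ = 1) ∧ ‖c‖ ≤ 2 ∧ (∀ i, ⟪u i, u i⟫_ℝ = ⟪u i, c⟫_ℝ) ∧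
      ∀ a, ‖∑ i, (H a i * s i) • u i‖ ≤ (n + 1) * τ := by
  obtain ⟨⟨hpsd, hdiag⟩, hopt⟩ := hX
  obtain ⟨B, hB⟩ := exists_conjTranspose_mul_self hpsd
  set b : Fin m ⊕ Unit → EuclideanSpace ℝ (Fin m ⊕ Unit) := fun k => WithLp.toLp 2 fun l => B l k
    with hb
  have hXb : ∀ k l, X k l = ⟪b k, b l⟫_ℝ := by
    intro k l
    rw [hB]
    simp [hb, Matrix.mul_apply, PiLp.inner_apply, mul_comm]
  have hs2 : ∀ i, s i * s i = 1 := fun i => by rcases hs i with h | h <;> simp [h]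
  have hbn : ∀ k, ⟪b k, b k⟫_ℝ = 1 := fun k => by rw [← hXb, hdiag]
  have hbnorm : ∀ k, ‖b k‖ = 1 := fun k => by
    have := hbn k
    rw [real_inner_self_eq_norm_sq] at this
    exact (pow_eq_one_iff_of_nonneg (norm_nonneg _) two_ne_zero).1 this
  set b₀ := b (Sum.inr ()) with hb0
  set u : Fin m → EuclideanSpace ℝ (Fin m ⊕ Unit) := fun i => b₀ - s i • b (Sum.inl i) with hu
  have huu : ∀ i, ⟪u i, u i⟫_ℝ = 2 - 2 * (s i * X (Sum.inl i) (Sum.inr ())) := by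
    intro i
    simp only [hu, inner_sub_left, inner_sub_right, real_inner_smul_left, inner_smul_right]
    rw [hbn, hbn, real_inner_comm (b (Sum.inl i)) b₀, hXb]
    linear_combination hs2 i
  have huc : ∀ i, ⟪u i, u i⟫_ℝ = ⟪u i, (2 : ℝ) • b₀⟫_ℝ := by
    intro i
    rw [huu]
    simp only [hu, inner_sub_left, real_inner_smul_left, inner_smul_right]
    rw [hbn, hXb]
    ring
  obtain ⟨i₀, hi₀⟩ : ∃ i, 2 ≤ ⟪u i, u i⟫_ℝ := by
    obtain ⟨i, hi⟩ := Function.ne_iff.1 herr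
    refine ⟨i, ?_⟩
    rw [huu]
    unfold rounded sgn at hi
    rcases hs i with h | h
    · rw [h] at hi ⊢
      by_cases hx : 0 < X (Sum.inl i) (Sum.inr ())
      · simp [hx] at hi
      · linarith
    · rw [h] at hi ⊢
      by_cases hx : 0 < X (Sum.inl i) (Sum.inr ())
      · linarith
      · simp [hx] at hi
  -- The objective in terms of the `u i`.
  have hrow : ∀ a, ∑ k, costRow H (received H s v) a k • b k =
      -(∑ i, (H a i * s i) • u i) - v a • b₀ := by
    intro a
    rw [Fintype.sum_sum_type]
    simp only [costRow, Sum.elim_inl, Sum.elim_inr, hu, received, Finset.univ_unique,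
      Finset.sum_singleton, Pi.add_apply, Matrix.mulVec, dotProduct, smul_sub, smul_smul,
      Finset.sum_sub_distrib, mul_assoc, hs2, mul_one, ← Finset.sum_smul]
    rw [neg_add, add_smul, neg_smul, neg_smul]
    change _ + (-((∑ i, H a i * s i) • b₀) + -(v a • b₀)) = _
    abel
  -- Optimality, compared with the rank one point built from the transmitted message.
  have hval : ∑ a, ‖∑ k, costRow H (received H s v) a k • b k‖ ^ 2 ≤ ∑ a, v a ^ 2 := by
    rw [← trace_costMatrix_mul_gram H _ b X hXb]
    refine (hopt _ (feasible_rankOne hs)).trans (le_of_eq ?_)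
    rw [trace_costMatrix_mul_gram H _ (fun k => (Sum.elim s fun _ => (1 : ℝ)) k) _
      (fun k l => by simp [mul_comm])]
    refine Finset.sum_congr rfl fun a _ => ?_
    rw [Fintype.sum_sum_type]
    simp [costRow, received, Matrix.mulVec, dotProduct]
  have hsum : ∀ a, ‖∑ i, (H a i * s i) • u i‖ ≤ (n + 1) * τ := by
    intro a
    have hτ : 0 ≤ τ := (abs_nonneg _).trans (hv a)
    have h1 : ‖∑ k, costRow H (received H s v) a k • b k‖ ^ 2 ≤ (n * τ) ^ 2 := by
      refine (Finset.single_le_sum (f := fun a => ‖∑ k, costRow H (received H s v) a k • b k‖ ^ 2)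
        (fun a _ => sq_nonneg _) (Finset.mem_univ a)).trans (hval.trans ?_)
      have h2 : ∀ a ∈ Finset.univ, v a ^ 2 ≤ τ ^ 2 := fun a _ => sq_le_sq' (abs_le.1 (hv a)).1
        (abs_le.1 (hv a)).2
      refine (Finset.sum_le_card_nsmul _ _ _ h2).trans ?_
      have hn : (1 : ℝ) ≤ n := by exact_mod_cast a.pos
      rw [nsmul_eq_mul, Finset.card_univ, Fintype.card_fin, mul_pow]
      gcongr
      nlinarith
    have h2 := abs_le_of_sq_le_sq h1 (by positivity)
    rw [abs_of_nonneg (norm_nonneg _), hrow] at h2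
    have h3 : ‖∑ i, (H a i * s i) • u i‖ ≤
        ‖-(∑ i, (H a i * s i) • u i) - v a • b₀‖ + ‖v a • b₀‖ := by
      have := norm_add_le (-(∑ i, (H a i * s i) • u i) - v a • b₀) (v a • b₀)
      rwa [sub_add_cancel, norm_neg] at this
    have h4 : ‖v a • b₀‖ ≤ τ := by
      rw [norm_smul, hbnorm, mul_one]; exact hv a
    linarith
  -- The conditions are homogeneous, so everything may be divided by the largest norm.
  have : Nonempty (Fin m) := ⟨i₀⟩
  obtain ⟨i₁, hi₁⟩ := Finite.exists_max fun i => ‖u i‖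
  have ht : 1 ≤ ‖u i₁‖ := by
    have h1 := hi₁ i₀
    rw [real_inner_self_eq_norm_sq] at hi₀
    nlinarith [norm_nonneg (u i₀)]
  have htpos : 0 < ‖u i₁‖ := by linarith
  have hinv : ‖u i₁‖⁻¹ ≤ 1 := inv_le_one_of_one_le₀ ht
  refine ⟨fun i => ‖u i₁‖⁻¹ • u i, ‖u i₁‖⁻¹ • (2 : ℝ) • b₀, fun i => ?_, ⟨i₁, ?_⟩, ?_,
    fun i => ?_, fun a => ?_⟩
  · rw [norm_smul, norm_inv, norm_norm, inv_mul_le_one₀ htpos]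
    exact hi₁ i
  · rw [norm_smul, norm_inv, norm_norm, inv_mul_cancel₀ htpos.ne']
  · rw [norm_smul, norm_inv, norm_norm, norm_smul, hbnorm]
    simp only [Real.norm_ofNat, mul_one]
    linarith
  · simp only [real_inner_smul_left, inner_smul_right _ _ ‖u i₁‖⁻¹]
    rw [huc]
  · simp only [smul_comm _ ‖u i₁‖⁻¹]
    rw [← Finset.smul_sum, norm_smul, norm_inv, norm_norm]
    exact (mul_le_of_le_one_left (norm_nonneg _) hinv).trans (hsum a)

/-! ### Gaussian small-ball and tail estimates -/

theorem gaussianReal_Icc_le {σ2 : ℝ≥0} (hσ2 : σ2 ≠ 0) (a b : ℝ) :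
    gaussianReal 0 σ2 (Set.Icc a b) ≤
      ENNReal.ofReal (√(2 * Real.pi * σ2))⁻¹ * ENNReal.ofReal (b - a) := by
  rw [gaussianReal_apply 0 hσ2]
  calc ∫⁻ x in Set.Icc a b, gaussianPDF 0 σ2 x
      ≤ ∫⁻ _ in Set.Icc a b, ENNReal.ofReal (√(2 * Real.pi * σ2))⁻¹ := by
        refine lintegral_mono fun x => ENNReal.ofReal_le_ofReal ?_
        refine mul_le_of_le_one_right (by positivity) (Real.exp_le_one_iff.2 ?_)
        exact div_nonpos_of_nonpos_of_nonneg (by nlinarith [sq_nonneg (x - 0)]) (by positivity)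
    _ = _ := by rw [setLIntegral_const, Real.volume_Icc]

/-- The Chernoff bound, with the parameter `t` left free. -/
theorem measure_abs_ge_le_of_gaussian {Ω : Type*} [MeasurableSpace Ω] {P : Measure Ω}
    {X : Ω → ℝ} {w : ℝ≥0} (hX : HasLaw X (gaussianReal 0 w) P) (x : ℝ) {t : ℝ} (ht : 0 ≤ t) :
    P {ω | x ≤ |X ω|} ≤ ENNReal.ofReal (2 * Real.exp (-t * x + w * t ^ 2 / 2)) := by
  have hms : MeasurableSet {y : ℝ | x ≤ |y|} := measurableSet_le measurable_const measurable_norm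
  rw [hX.measure_eq hms]
  have hg : gaussianReal 0 w {y | x ≤ y} ≤ ENNReal.ofReal (Real.exp (-t * x + w * t ^ 2 / 2)) := by
    have h := measure_ge_le_exp_mul_mgf (X := id) (μ := gaussianReal 0 w) x ht
      (by simpa using integrable_exp_mul_gaussianReal t)
    rw [mgf_id_gaussianReal, ← Real.exp_add, zero_mul, zero_add] at h
    rw [← ofReal_measureReal]
    exact ENNReal.ofReal_le_ofReal h
  have hneg : gaussianReal 0 w {y | y ≤ -x} = gaussianReal 0 w {y | x ≤ y} := by
    have h := gaussianReal_map_neg (μ := 0) (v := w)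
    rw [neg_zero] at h
    conv_rhs => rw [← h]
    rw [show {y : ℝ | x ≤ y} = Set.Ici x from rfl, Measure.map_apply measurable_neg measurableSet_Ici]
    congr 1
    ext y
    simp
  have hsub : {y : ℝ | x ≤ |y|} ⊆ {y | x ≤ y} ∪ {y | y ≤ -x} := by
    intro y hy
    rcases le_abs.1 (show x ≤ |y| from hy) with h | h
    · exact Or.inl h
    · exact Or.inr (by simp only [Set.mem_ofPred_eq]; linarith)
  refine (measure_mono hsub).trans ((measure_union_le _ _).trans ?_)
  rw [hneg, two_mul, ENNReal.ofReal_add (by positivity) (by positivity)]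
  exact add_le_add hg hg

/-- If `X` has a density bounded by `D` and is independent of `Y`, then the event that `T X + g(Y)` is
small costs a factor `D * (2 K / |T|)` on top of any event determined by `Y`. -/
theorem measure_abs_mul_add_le {Ω β : Type*} [MeasurableSpace Ω] [MeasurableSpace β]
    {P : Measure Ω} [IsProbabilityMeasure P] {X : Ω → ℝ} {Y : Ω → β} (hX : AEMeasurable X P)
    (hY : AEMeasurable Y P) (hXY : IndepFun X Y P) {D : ℝ≥0∞}
    (hD : ∀ a b, P.map X (Set.Icc a b) ≤ D * ENNReal.ofReal (b - a)) {S : Set β}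
    (hS : MeasurableSet S) {g : β → ℝ} (hg : Measurable g) {T : ℝ} (hT : T ≠ 0) (K : ℝ) :
    P {ω | Y ω ∈ S ∧ |T * X ω + g (Y ω)| ≤ K} ≤
      D * ENNReal.ofReal (2 * K / |T|) * P {ω | Y ω ∈ S} := by
  have hTpos : 0 < |T| := abs_pos.2 hT
  have := Measure.isProbabilityMeasure_map (μ := P) hX
  have := Measure.isProbabilityMeasure_map (μ := P) hY
  set B : Set (ℝ × β) := {z | z.2 ∈ S ∧ |T * z.1 + g z.2| ≤ K} with hB
  have hBm : MeasurableSet B := by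
    have h0 : Measurable fun z : ℝ × β => |T * z.1 + g z.2| :=
      ((measurable_const.mul measurable_fst).add (hg.comp measurable_snd)).norm
    exact (measurable_snd hS).inter (measurableSet_le h0 measurable_const)
  have h1 : P {ω | Y ω ∈ S ∧ |T * X ω + g (Y ω)| ≤ K} =
      ((P.map X).prod (P.map Y)) B := by
    rw [← hXY.map_prod_eq_prod_map_map hX hY, Measure.map_apply_of_aemeasurable (hX.prodMk hY) hBm]
    rfl
  have h2 : P {ω | Y ω ∈ S} = P.map Y S := by
    rw [Measure.map_apply_of_aemeasurable hY hS]; rfl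
  rw [h1, h2, Measure.prod_apply_symm hBm]
  calc ∫⁻ y, P.map X ((fun x => (x, y)) ⁻¹' B) ∂(P.map Y)
      ≤ ∫⁻ y, S.indicator (fun _ => D * ENNReal.ofReal (2 * K / |T|)) y ∂(P.map Y) := by
        refine lintegral_mono fun y => ?_
        by_cases hy : y ∈ S
        · rw [Set.indicator_of_mem hy]
          have hsub : (fun x => (x, y)) ⁻¹' B ⊆
              Set.Icc (-g y / T - K / |T|) (-g y / T + K / |T|) := by
            rintro x ⟨-, hx⟩
            have h3 : |x - -g y / T| ≤ K / |T| := by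
              rw [le_div_iff₀ hTpos, ← abs_mul]
              have : (x - -g y / T) * T = T * x + g y := by field_simp; ring
              rw [this]
              exact hx
            rw [abs_le] at h3
            constructor <;> linarith [h3.1, h3.2]
          refine (measure_mono hsub).trans ((hD _ _).trans (le_of_eq ?_))
          congr 2
          ring
        · rw [Set.indicator_of_notMem hy]
          have : (fun x => (x, y)) ⁻¹' B = ∅ := by
            ext x; simp [hB, hy]
          rw [this, measure_empty]
    _ = _ := by rw [lintegral_indicator_const hS]

/-- Anticoncentration of linear forms in independent variables with bounded densities. The forms are
triangular with respect to the variables `X (piv l)`: forms of larger or equal `key` do not involve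
the pivot variable of `l`, which can therefore be integrated out first. -/
theorem measure_forall_abs_form_le {Ω ι Λ : Type*} [MeasurableSpace Ω] [Fintype ι]
    {P : Measure Ω} [IsProbabilityMeasure P] {X : ι → Ω → ℝ} (hX : ∀ i, AEMeasurable (X i) P)
    (hind : iIndepFun X P) {D : ℝ≥0∞}
    (hD : ∀ i a b, P.map (X i) (Set.Icc a b) ≤ D * ENNReal.ofReal (b - a))
    (B : Λ → ι → ℝ) (piv : Λ → ι) (key : Λ → ℕ) (hpiv : ∀ l, B l (piv l) ≠ 0)
    (htri : ∀ l l', l ≠ l' → key l ≤ key l' → B l' (piv l) = 0) (K : ℝ) (F : Finset Λ) :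
    P {ω | ∀ l ∈ F, |∑ i, B l i * X i ω| ≤ K} ≤
      ∏ l ∈ F, D * ENNReal.ofReal (2 * K / |B l (piv l)|) := by
  classical
  induction F using Finset.induction_on_min_value key with
  | empty => simp
  | insert a F ha hmin ih =>
    rw [Finset.prod_insert ha]
    -- The forms in `F` depend only on the variables other than `X (piv a)`.
    set R : Finset ι := Finset.univ.erase (piv a) with hR
    set Y : Ω → (R → ℝ) := fun ω i => X i ω with hYdef
    have hY : AEMeasurable Y P := aemeasurable_pi_lambda _ fun i => hX i
    have hdisj : Disjoint ({piv a} : Finset ι) R := by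
      rw [Finset.disjoint_singleton_left]; simp [hR]
    have hXY : IndepFun (X (piv a)) Y P := by
      have h := iIndepFun.indepFun_finset₀ {piv a} R hdisj hind hX
      exact h.comp (φ := fun z : ({piv a} : Finset ι) → ℝ => z ⟨piv a, by simp⟩) (ψ := id)
        (measurable_pi_apply _) measurable_id
    set form : Λ → (R → ℝ) → ℝ := fun l y => ∑ i : R, B l i * y i with hform
    have hformm : ∀ l, Measurable (form l) := fun l =>
      Finset.measurable_sum _ fun i _ => measurable_const.mul (measurable_pi_apply i)
    have hsplit : ∀ l ω, ∑ i, B l i * X i ω = B l (piv a) * X (piv a) ω + form l (Y ω) := by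
      intro l ω
      rw [← Finset.add_sum_erase Finset.univ _ (Finset.mem_univ (piv a))]
      congr 1
      simp only [hform, hYdef]
      exact (Finset.sum_coe_sort R fun i => B l i * X i ω).symm
    set S : Set (R → ℝ) := {y | ∀ l ∈ F, |form l y| ≤ K} with hS
    have hSm : MeasurableSet S := by
      have : S = ⋂ l ∈ F, {y | |form l y| ≤ K} := by ext y; simp [hS]
      rw [this]
      exact Finset.measurableSet_biInter F fun l _ =>
        measurableSet_le (hformm l).norm measurable_const
    have hF : ∀ ω, (∀ l ∈ F, |∑ i, B l i * X i ω| ≤ K) ↔ Y ω ∈ S := by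
      intro ω
      simp only [hS, Set.mem_ofPred_eq]
      refine forall₂_congr fun l hl => ?_
      rw [hsplit, htri a l (fun h => ha (h ▸ hl)) (hmin l hl), zero_mul, zero_add]
    have hset : {ω | ∀ l ∈ insert a F, |∑ i, B l i * X i ω| ≤ K} =
        {ω | Y ω ∈ S ∧ |B a (piv a) * X (piv a) ω + form a (Y ω)| ≤ K} := by
      ext ω
      rw [Set.mem_ofPred_eq, Set.mem_ofPred_eq, Finset.forall_mem_insert, hF, hsplit, and_comm]
    rw [hset]
    refine (measure_abs_mul_add_le (hX _) hY hXY (hD _) hSm (hformm a) (hpiv a) K).trans ?_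
    gcongr
    simpa only [hF] using ih

/-- For a fixed matrix with lower triangular pivot rows, the entries of `H diag(s) A` are triangular
linear forms in the entries of `H`, with pivot variables `H a (p j)` and coefficients `± T j`. -/
theorem measure_forall_triangular_le {Ω : Type*} [MeasurableSpace Ω] {P : Measure Ω}
    [IsProbabilityMeasure P] {n m d : ℕ} {H : Ω → Matrix (Fin n) (Fin m) ℝ}
    (hH : ∀ i j, AEMeasurable (fun ω => H ω i j) P)
    (hind : iIndepFun (fun (p : Fin n × Fin m) ω => H ω p.1 p.2) P) {D : ℝ≥0∞}
    (hD : ∀ i j a b, P.map (fun ω => H ω i j) (Set.Icc a b) ≤ D * ENNReal.ofReal (b - a))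
    {s : Fin m → ℝ} (hs : s ∈ messages m) {p : Fin d → Fin m} {T : Fin d → ℕ}
    (hT : ∀ j, 1 ≤ T j) {A : Fin m → Fin d → ℤ} (hdiag : ∀ k, A (p k) k = T k)
    (hupper : ∀ k j, k < j → A (p k) j = 0) (K : ℝ) :
    P {ω | ∀ a j, |∑ i, H ω a i * s i * A i j| ≤ K} ≤
      ∏ j, (D * ENNReal.ofReal (2 * K / T j)) ^ n := by
  have habs : ∀ i, |s i| = 1 := fun i => by rcases hs i with h | h <;> simp [h]
  have hTpos : ∀ j, (0 : ℝ) < T j := fun j => by exact_mod_cast hT j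
  let B : Fin n × Fin d → Fin n × Fin m → ℝ := fun l q =>
    if q.1 = l.1 then s q.2 * A q.2 l.2 else 0
  have hBp : ∀ l, |B l (l.1, p l.2)| = T l.2 := by
    intro l
    simp only [B, if_true, abs_mul, habs, hdiag]
    simp
  have h := measure_forall_abs_form_le (X := fun (q : Fin n × Fin m) ω => H ω q.1 q.2)
    (fun q => hH q.1 q.2) hind (fun q => hD q.1 q.2) B (fun l => (l.1, p l.2))
    (fun l => (l.2 : ℕ)) (fun l => abs_pos.1 (by rw [hBp]; exact hTpos _)) (by
      rintro ⟨a, j⟩ ⟨a', j'⟩ hne hle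
      simp only [B]
      split_ifs with haa
      · have hjj : j < j' := by
          refine lt_of_le_of_ne hle fun h => hne ?_
          rw [haa, h]
        rw [hupper j j' hjj]; simp
      · rfl) K Finset.univ
  have hset : {ω | ∀ a j, |∑ i, H ω a i * s i * A i j| ≤ K} =
      {ω | ∀ l ∈ (Finset.univ : Finset (Fin n × Fin d)),
        |∑ q, B l q * H ω q.1 q.2| ≤ K} := by
    ext ω
    have hsum : ∀ l : Fin n × Fin d, ∑ q, B l q * H ω q.1 q.2 =
        ∑ i, H ω l.1 i * s i * A i l.2 := by
      intro l
      rw [Fintype.sum_prod_type, Finset.sum_eq_single l.1]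
      · refine Finset.sum_congr rfl fun i _ => ?_
        simp only [B, if_true]; ring
      · intro a _ ha
        exact Finset.sum_eq_zero fun i _ => by simp [B, ha]
      · simp
    simp only [Set.mem_ofPred_eq, hsum, Finset.mem_univ, true_imp_iff, Prod.forall]
  rw [hset]
  refine h.trans (le_of_eq ?_)
  simp only [hBp]
  rw [Fintype.prod_prod_type_right]
  refine Finset.prod_congr rfl fun j _ => ?_
  simp

/-! ### Summation over all admissible matrices -/

/-- The truncated subtraction is intended: the terms with `j ≥ r` vanish. -/
theorem two_mul_sum_range_tsub (r d : ℕ) :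
    2 * ∑ j ∈ Finset.range d, (r - j) + (r - d) * (r - d + 1) = r * (r + 1) := by
  induction d with
  | zero => simp
  | succ d ih =>
    rw [Finset.sum_range_succ, ← ih]
    rcases Nat.lt_or_ge d r with h | h
    · obtain ⟨k, rfl⟩ := Nat.exists_eq_add_of_lt h
      have h1 : d + k + 1 - d = k + 1 := by omega
      have h2 : d + k + 1 - (d + 1) = k := by omega
      rw [h1, h2]
      ring
    · have h1 : r - d = 0 := by omega
      have h2 : r - (d + 1) = 0 := by omega
      rw [h1, h2]
      ring

theorem sum_range_tsub_le (r d : ℕ) : ∑ j ∈ Finset.range d, (r - j) ≤ r * (r + 1) / 2 := by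
  rw [Nat.le_div_iff_mul_le two_pos, ← two_mul_sum_range_tsub r d]
  omega

/-- The sum of `t ^ (a - b)` is at most `M ^ k` times a harmonic sum, for any natural
`k ≥ a - b + 1`. In particular `k = 0` is allowed for negative exponents `a - b`. -/
theorem sum_Icc_pow_div_pow_le (a b k M : ℕ) (hM : 0 < M) (hab : a + 1 ≤ b + k) :
    ∑ t ∈ Finset.Icc 1 M, (t : ℝ) ^ a / (t : ℝ) ^ b ≤ (M : ℝ) ^ k * (1 + Real.log M) := by
  have hterm : ∀ t ∈ Finset.Icc 1 M, (t : ℝ) ^ a / (t : ℝ) ^ b ≤ (M : ℝ) ^ k * (t : ℝ)⁻¹ := by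
    intro t ht
    obtain ⟨h1, h2⟩ := Finset.mem_Icc.1 ht
    have htpos : (0 : ℝ) < t := by exact_mod_cast h1
    have ht1 : (1 : ℝ) ≤ t := by exact_mod_cast h1
    have htM : (t : ℝ) ≤ M := by exact_mod_cast h2
    rw [div_le_iff₀ (by positivity), ← div_eq_mul_inv, div_mul_eq_mul_div, le_div_iff₀ htpos,
      ← pow_succ]
    calc (t : ℝ) ^ (a + 1) ≤ (t : ℝ) ^ (k + b) := pow_le_pow_right₀ ht1 (by omega)
      _ = (t : ℝ) ^ k * (t : ℝ) ^ b := pow_add _ _ _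
      _ ≤ (M : ℝ) ^ k * (t : ℝ) ^ b := by gcongr
  refine (Finset.sum_le_sum hterm).trans ?_
  rw [← Finset.mul_sum]
  gcongr
  have h := harmonic_le_one_add_log M
  rw [harmonic_eq_sum_Icc] at h
  push_cast at h
  exact h

/-- The values allowed for the pivots: the first one is `M`, the others lie in `[1, M]`. -/
def pivotRange (d M : ℕ) (j : Fin (d + 1)) : Finset ℕ :=
  if j = 0 then {M} else Finset.Icc 1 M

/-- The sum over all pivots of the number of matrices times the probability for each of them, up to
constants. The first pivot, fixed to be `M`, contributes `M ^ (-n)`, and the sum over the `j`-th one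
contributes `M ^ (r + 1 - j)` for `1 ≤ j ≤ r` and only a logarithm beyond that. -/
theorem sum_pivot_weights_le (n r d : ℕ) (hd : d ≤ n + r) {M : ℕ} (hM : 0 < M) :
    ∑ T ∈ Fintype.piFinset (pivotRange d M),
      (∏ j, (T j : ℝ) ^ (n + r - (j : ℕ)) / (T j : ℝ) ^ n) / (M : ℝ) ^ (n + r) ≤
      (1 + Real.log M) ^ d * ((M : ℝ) ^ (r * (r + 1) / 2) / (M : ℝ) ^ n) := by
  have hMR : (0 : ℝ) < M := by exact_mod_cast hM
  have hM1 : (1 : ℝ) ≤ M := by exact_mod_cast hM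
  rw [← Finset.sum_div, ← Finset.prod_univ_sum (pivotRange d M)
    (fun j t => (t : ℝ) ^ (n + r - (j : ℕ)) / (t : ℝ) ^ n), Fin.prod_univ_succ]
  have h0 : ∑ t ∈ pivotRange d M 0, (t : ℝ) ^ (n + r - ((0 : Fin (d + 1)) : ℕ)) / (t : ℝ) ^ n =
      (M : ℝ) ^ (n + r) / (M : ℝ) ^ n := by
    simp [pivotRange]
  have h1 : ∏ j : Fin d, ∑ t ∈ pivotRange d M j.succ,
      (t : ℝ) ^ (n + r - (j.succ : ℕ)) / (t : ℝ) ^ n ≤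
      (1 + Real.log M) ^ d * (M : ℝ) ^ (r * (r + 1) / 2) := by
    calc _ ≤ ∏ j : Fin d, (M : ℝ) ^ (r - (j : ℕ)) * (1 + Real.log M) := by
          refine Finset.prod_le_prod (fun j _ => Finset.sum_nonneg fun t _ => by positivity)
            fun j _ => ?_
          rw [pivotRange, if_neg (Fin.succ_ne_zero j)]
          refine sum_Icc_pow_div_pow_le _ _ _ M hM ?_
          have := j.2
          rw [Fin.val_succ]
          omega
      _ = (1 + Real.log M) ^ d * (M : ℝ) ^ (∑ j ∈ Finset.range d, (r - j)) := by
          rw [Finset.prod_mul_distrib, Fin.prod_const, mul_comm, Finset.prod_pow_eq_pow_sum,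
            Finset.sum_range]
      _ ≤ _ := by
          have hlog := Real.log_nonneg hM1
          gcongr
          exact sum_range_tsub_le r d
  rw [h0, div_le_iff₀ (by positivity)]
  calc _ ≤ (M : ℝ) ^ (n + r) / (M : ℝ) ^ n *
        ((1 + Real.log M) ^ d * (M : ℝ) ^ (r * (r + 1) / 2)) := by gcongr
    _ = _ := by field_simp

/-- The constant in `measure_exists_admissible_le`, where `D` bounds the density of the channel
entries. -/
def pivotConst (n m d : ℕ) (D : ℝ) : ℝ :=
  (slabConst (d + 1) * admissibleConst d (3 * (m + 1))) ^ m * (2 * D) ^ (n * (d + 1))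

theorem pivotConst_nonneg (n m d : ℕ) {D : ℝ} (hD : 0 ≤ D) : 0 ≤ pivotConst n m d D := by
  unfold pivotConst slabConst admissibleConst
  positivity

/-- The union bound over all pivots and all admissible matrices, for one message and one choice of the
pivot rows. -/
theorem measure_exists_admissible_le {Ω : Type*} [MeasurableSpace Ω] {P : Measure Ω}
    [IsProbabilityMeasure P] {n m r d : ℕ} (hm : m = n + r) {H : Ω → Matrix (Fin n) (Fin m) ℝ}
    (hH : ∀ i j, AEMeasurable (fun ω => H ω i j) P)
    (hind : iIndepFun (fun (p : Fin n × Fin m) ω => H ω p.1 p.2) P) {D : ℝ} (hD0 : 0 ≤ D)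
    (hD : ∀ i j a b, P.map (fun ω => H ω i j) (Set.Icc a b) ≤
      ENNReal.ofReal D * ENNReal.ofReal (b - a))
    {s : Fin m → ℝ} (hs : s ∈ messages m) {p : Fin (d + 1) → Fin m} (hp : Function.Injective p)
    {M : ℕ} (hM : 0 < M) {K : ℝ} (hK : 0 ≤ K) :
    P {ω | ∃ T A, (∀ j, 1 ≤ T j) ∧ (∀ j, T j ≤ M) ∧ T 0 = M ∧
      Admissible (3 * (m + 1)) M p T A ∧ ∀ a j, |∑ i, H ω a i * s i * A i j| ≤ K} ≤
      ENNReal.ofReal (pivotConst n m d D * K ^ (n * (d + 1)) *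
        ((1 + Real.log M) ^ d * ((M : ℝ) ^ (r * (r + 1) / 2) / (M : ℝ) ^ n))) := by
  classical
  have hdm : d + 1 ≤ m := by simpa using Fintype.card_le_of_injective p hp
  set G : (Fin m → Fin (d + 1) → ℤ) → Set Ω := fun A =>
    {ω | ∀ a j, |∑ i, H ω a i * s i * A i j| ≤ K} with hG
  let box : (Fin (d + 1) → ℕ) → Finset (Fin m → Fin (d + 1) → ℤ) := fun T =>
    (Fintype.piFinset fun _ => Fintype.piFinset fun j =>
      Finset.Icc (-(2 * (T j : ℤ))) (2 * (T j : ℤ))).filter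
        fun A => Admissible (3 * (m + 1)) M p T A
  have hrange : ∀ {T : Fin (d + 1) → ℕ}, T ∈ Fintype.piFinset (pivotRange d M) →
      (∀ j, 1 ≤ T j) ∧ (∀ j, T j ≤ M) ∧ T 0 = M := by
    intro T hT
    rw [Fintype.mem_piFinset] at hT
    have h0 : T 0 = M := by simpa [pivotRange] using hT 0
    have h1 : ∀ j, 1 ≤ T j ∧ T j ≤ M := by
      intro j
      by_cases hj : j = 0
      · rw [hj, h0]; exact ⟨hM, le_rfl⟩
      · simpa [pivotRange, hj] using hT j
    exact ⟨fun j => (h1 j).1, fun j => (h1 j).2, h0⟩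
  have hcover : {ω | ∃ T A, (∀ j, 1 ≤ T j) ∧ (∀ j, T j ≤ M) ∧ T 0 = M ∧
      Admissible (3 * (m + 1)) M p T A ∧ ∀ a j, |∑ i, H ω a i * s i * A i j| ≤ K} ⊆
      ⋃ T ∈ Fintype.piFinset (pivotRange d M), ⋃ A ∈ box T, G A := by
    rintro ω ⟨T, A, h1, h2, h3, h4, h5⟩
    refine Set.mem_biUnion (x := T) ?_ (Set.mem_biUnion (x := A) ?_ h5)
    · rw [Finset.mem_coe, Fintype.mem_piFinset]
      intro j
      by_cases hj : j = 0
      · simp [pivotRange, hj, h3]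
      · simp [pivotRange, hj, h1 j, h2 j]
    · rw [Finset.mem_coe, Finset.mem_filter, Fintype.mem_piFinset]
      refine ⟨fun i => ?_, h4⟩
      rw [Fintype.mem_piFinset]
      exact fun j => Finset.mem_Icc.2 (abs_le.1 (h4.box i j))
  refine (measure_mono hcover).trans ((measure_biUnion_finset_le _ _).trans ?_)
  have hstep : ∀ T ∈ Fintype.piFinset (pivotRange d M), P (⋃ A ∈ box T, G A) ≤
      ENNReal.ofReal (pivotConst n m d D * K ^ (n * (d + 1)) *
        ((∏ j, (T j : ℝ) ^ (n + r - (j : ℕ)) / (T j : ℝ) ^ n) / (M : ℝ) ^ (n + r))) := by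
    intro T hT
    obtain ⟨hT1, hTM, hT0⟩ := hrange hT
    have hA : ∀ A ∈ box T, P (G A) ≤
        ENNReal.ofReal (∏ j, (D * (2 * K / T j)) ^ n) := by
      intro A hA
      have hadm := (Finset.mem_filter.1 hA).2
      refine (measure_forall_triangular_le hH hind hD hs hT1 hadm.diag hadm.upper K).trans
        (le_of_eq ?_)
      rw [ENNReal.ofReal_prod_of_nonneg fun j _ => by positivity]
      refine Finset.prod_congr rfl fun j _ => ?_
      rw [← ENNReal.ofReal_mul hD0, ENNReal.ofReal_pow (by positivity)]
    refine (measure_biUnion_finset_le _ _).trans ((Finset.sum_le_card_nsmul _ _ _ hA).trans ?_)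
    rw [nsmul_eq_mul, ← ENNReal.ofReal_natCast, ← ENNReal.ofReal_mul (Nat.cast_nonneg _)]
    refine ENNReal.ofReal_le_ofReal ?_
    have hcard := admissible_card_le (C := 3 * ((m : ℝ) + 1)) (by positivity) hM hp hT1 hTM hT0
      (box T) fun A hA => (Finset.mem_filter.1 hA).2
    refine (mul_le_mul_of_nonneg_right hcard
      (Finset.prod_nonneg fun j _ => by positivity)).trans (le_of_eq ?_)
    have hprod : ∏ j, (D * (2 * K / T j)) ^ n =
        (2 * D) ^ (n * (d + 1)) * K ^ (n * (d + 1)) * (∏ j, (T j : ℝ) ^ n)⁻¹ := by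
      have : ∀ j, (D * (2 * K / T j)) ^ n = (2 * D * K) ^ n * ((T j : ℝ) ^ n)⁻¹ := fun j => by
        rw [← inv_pow, ← mul_pow]
        congr 1
        ring
      simp only [this]
      rw [Finset.prod_mul_distrib, Fin.prod_const, ← pow_mul, mul_pow, Finset.prod_inv_distrib]
    rw [hprod, pivotConst, ← hm, Finset.prod_div_distrib]
    ring
  refine (Finset.sum_le_sum hstep).trans ?_
  have hC := pivotConst_nonneg n m d hD0
  rw [← ENNReal.ofReal_sum_of_nonneg fun T _ => by positivity, ← Finset.mul_sum]
  refine ENNReal.ofReal_le_ofReal (mul_le_mul_of_nonneg_left ?_ (by positivity))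
  exact sum_pivot_weights_le n r d (by omega) hM

/-! ### The error probability at a fixed signal to noise ratio -/

theorem finite_messages (m : ℕ) : (messages m).Finite := by
  refine (Set.Finite.pi' (t := fun _ : Fin m => ({1, -1} : Set ℝ)) fun _ => by simp).subset ?_
  intro b hb i
  simpa using hb i

theorem measure_notMem_messages {Ω : Type*} [MeasurableSpace Ω] {P : Measure Ω} {m : ℕ}
    {s : Ω → Fin m → ℝ} (hs : HasLaw s (uniformOn (messages m)) P) :
    P {ω | s ω ∉ messages m} = 0 := by
  have hfin := finite_messages m
  have hne : (messages m).Nonempty := ⟨fun _ => 1, fun _ => Or.inl rfl⟩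
  rw [hs.measure_eq (p := fun b => b ∉ messages m) hfin.measurableSet.compl]
  have := isProbabilityMeasure_uniformOn hfin hne
  exact (prob_compl_eq_zero_iff hfin.measurableSet).2 (uniformOn_self hfin hne)

/-- When the channel entries are at most `L` and the noise entries at most `τ`, an error implies
that `H diag(s) A` is small for some admissible matrix `A`. -/
theorem mem_exceptional_of_mem_errorEvent {Ω : Type*} {n m : ℕ}
    {Xstar : Matrix (Fin n) (Fin m) ℝ → (Fin n → ℝ) → Matrix (Fin m ⊕ Unit) (Fin m ⊕ Unit) ℝ}
    (hXstar : ∀ G y, IsOptimal G y (Xstar G y)) {H : Ω → Matrix (Fin n) (Fin m) ℝ}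
    {s : Ω → Fin m → ℝ} {v : Ω → Fin n → ℝ} {L τ : ℝ} {M : ℕ} (hM : 2 ≤ M)
    (hMτ : M * ((n + 1) * τ) ≤ 1) {ω : Ω} (hω : ω ∈ errorEvent Xstar H s v)
    (hs : s ω ∈ messages m) (hL : ∀ a i, |H ω a i| ≤ L) (hτ : ∀ a, |v ω a| ≤ τ) :
    ∃ d ∈ Finset.range m, ∃ p : Fin (d + 1) → Fin m, Function.Injective p ∧
      ∃ T A, (∀ j, 1 ≤ T j) ∧ (∀ j, T j ≤ M) ∧ T 0 = M ∧
      Admissible (3 * (m + 1)) M p T A ∧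
      ∀ a j, |∑ i, H ω a i * s ω i * A i j| ≤ 1 + m * L := by
  obtain ⟨u, c, hu, hu1, hc, huc, hsmall⟩ := exists_sphere_of_error hs
    (hXstar (H ω) (received (H ω) (s ω) (v ω))) hω hτ
  obtain ⟨d, p, T, A, hp, h1, h2, h3, h4, h5⟩ := exists_admissible_of_sphere hu hu1 hc huc hM
  have hdm : d + 1 ≤ m := by simpa using Fintype.card_le_of_injective p hp
  refine ⟨d, Finset.mem_range.2 hdm, p, hp, T, A, h1, h2, h3, h4, fun a j => ?_⟩
  have h6 := h5 (fun i => H ω a i * s ω i) L ((n + 1) * τ) (fun i => by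
    have : |s ω i| = 1 := by rcases hs i with h | h <;> simp [h]
    rw [abs_mul, this, mul_one]
    exact hL a i) (hsmall a) j
  linarith

/-- The constant in front of the main term of `measure_errorEvent_le`: the sum over all messages and
all choices of the pivot rows. -/
noncomputable def errorConst (n m : ℕ) (D : ℝ) : ℝ :=
  ∑ _s ∈ (finite_messages m).toFinset, ∑ d ∈ Finset.range m,
    ∑ _p : Fin (d + 1) → Fin m, pivotConst n m d D

theorem errorConst_nonneg (n m : ℕ) {D : ℝ} (hD : 0 ≤ D) : 0 ≤ errorConst n m D :=
  Finset.sum_nonneg fun _ _ => Finset.sum_nonneg fun _ _ => Finset.sum_nonneg fun _ _ =>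
    pivotConst_nonneg n m _ hD

theorem measure_errorEvent_le {Ω : Type*} [MeasurableSpace Ω] {P : Measure Ω}
    [IsProbabilityMeasure P] {n m r : ℕ} (hm : m = n + r) {σ2 : ℝ≥0} (hσ2 : σ2 ≠ 0) {ρ : ℝ}
    (hρ : 0 < ρ) {H : Ω → Matrix (Fin n) (Fin m) ℝ} {s : Ω → Fin m → ℝ} {v : Ω → Fin n → ℝ}
    (hmodel : IsGaussianModel P σ2 ρ H s v)
    {Xstar : Matrix (Fin n) (Fin m) ℝ → (Fin n → ℝ) → Matrix (Fin m ⊕ Unit) (Fin m ⊕ Unit) ℝ}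
    (hXstar : ∀ G y, IsOptimal G y (Xstar G y)) {L τ : ℝ} (hL : 0 ≤ L) {M : ℕ} (hM : 2 ≤ M)
    (hMτ : M * ((n + 1) * τ) ≤ 1) {t₁ t₂ : ℝ} (ht₁ : 0 ≤ t₁) (ht₂ : 0 ≤ t₂) :
    P (errorEvent Xstar H s v) ≤ ENNReal.ofReal (
      n * m * (2 * Real.exp (-t₁ * L + σ2 * t₁ ^ 2 / 2)) +
      n * (2 * Real.exp (-t₂ * τ + ρ⁻¹ * t₂ ^ 2 / 2)) +
      errorConst n m (√(2 * Real.pi * σ2))⁻¹ * (1 + m * L) ^ (n * m) *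
        ((1 + Real.log M) ^ m * ((M : ℝ) ^ (r * (r + 1) / 2) / (M : ℝ) ^ n))) := by
  classical
  set D : ℝ := (√(2 * Real.pi * σ2))⁻¹ with hDdef
  have hD0 : 0 ≤ D := by positivity
  have hM1 : (1 : ℝ) ≤ M := by exact_mod_cast (by omega : 1 ≤ M)
  have hlog := Real.log_nonneg hM1
  set K : ℝ := 1 + m * L with hK
  have hK1 : 1 ≤ K := by rw [hK]; nlinarith [(Nat.cast_nonneg m : (0 : ℝ) ≤ m)]
  have hD : ∀ i j a b, P.map (fun ω => H ω i j) (Set.Icc a b) ≤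
      ENNReal.ofReal D * ENNReal.ofReal (b - a) := by
    intro i j a b
    rw [(hmodel.channel_law i j).map_eq]
    exact gaussianReal_Icc_le hσ2 a b
  let U : (Fin m → ℝ) → (d : ℕ) → (Fin (d + 1) → Fin m) → Set Ω := fun b d p =>
    {ω | Function.Injective p ∧ ∃ T A, (∀ j, 1 ≤ T j) ∧ (∀ j, T j ≤ M) ∧ T 0 = M ∧
      Admissible (3 * (m + 1)) M p T A ∧ ∀ a j, |∑ i, H ω a i * b i * A i j| ≤ K}
  have hU : ∀ b ∈ (finite_messages m).toFinset, ∀ d ∈ Finset.range m, ∀ p, P (U b d p) ≤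
      ENNReal.ofReal (pivotConst n m d D * (K ^ (n * m) *
        ((1 + Real.log M) ^ m * ((M : ℝ) ^ (r * (r + 1) / 2) / (M : ℝ) ^ n)))) := by
    intro b hb d hd p
    rw [Set.Finite.mem_toFinset] at hb
    have hdm : d + 1 ≤ m := Finset.mem_range.1 hd
    by_cases hp : Function.Injective p
    · have h := measure_exists_admissible_le hm (fun i j => (hmodel.channel_law i j).aemeasurable)
        hmodel.channel_indep hD0 hD hb hp (M := M) (by omega) (K := K) (by linarith)
      have hUeq : U b d p = {ω | ∃ T A, (∀ j, 1 ≤ T j) ∧ (∀ j, T j ≤ M) ∧ T 0 = M ∧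
          Admissible (3 * (m + 1)) M p T A ∧ ∀ a j, |∑ i, H ω a i * b i * A i j| ≤ K} := by
        ext ω
        exact and_iff_right hp
      rw [hUeq]
      refine h.trans (ENNReal.ofReal_le_ofReal ?_)
      have hC := pivotConst_nonneg n m d hD0
      rw [mul_assoc]
      gcongr
      · linarith
      · omega
    · have : U b d p = ∅ := by
        ext ω
        exact ⟨fun h => absurd h.1 hp, fun h => h.elim⟩
      rw [this, measure_empty]
      exact zero_le
  have hcover : errorEvent Xstar H s v ⊆
      {ω | s ω ∉ messages m} ∪ ((⋃ a ∈ (Finset.univ : Finset (Fin n)),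
        ⋃ i ∈ (Finset.univ : Finset (Fin m)), {ω | L ≤ |H ω a i|}) ∪
      ((⋃ a ∈ (Finset.univ : Finset (Fin n)), {ω | τ ≤ |v ω a|}) ∪
      ⋃ b ∈ (finite_messages m).toFinset, ⋃ d ∈ Finset.range m,
        ⋃ p ∈ (Finset.univ : Finset (Fin (d + 1) → Fin m)), U b d p)) := by
    intro ω hω
    by_contra hcon
    simp only [Set.mem_union, Set.mem_iUnion, Set.mem_ofPred_eq, Finset.mem_univ, true_and,
      exists_prop, not_or, not_exists, not_and, not_not, not_le] at hcon
    obtain ⟨h1, h2, h3, h4⟩ := hcon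
    obtain ⟨d, hd, p, hp, h5⟩ := mem_exceptional_of_mem_errorEvent hXstar hM hMτ hω h1
      (fun a i => (h2 a i).le) (fun a => (h3 a).le)
    exact h4 (s ω) ((finite_messages m).mem_toFinset.2 h1) d hd p ⟨hp, h5⟩
  refine (measure_mono hcover).trans ((measure_union_le _ _).trans ?_)
  rw [measure_notMem_messages hmodel.message_law, zero_add, add_assoc,
    ENNReal.ofReal_add (by positivity) (by have := errorConst_nonneg n m hD0; positivity),
    ENNReal.ofReal_add (by positivity) (by have := errorConst_nonneg n m hD0; positivity)]
  refine (measure_union_le _ _).trans (add_le_add ?_ ((measure_union_le _ _).trans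
    (add_le_add ?_ ?_)))
  · refine (measure_biUnion_finset_le _ _).trans ((Finset.sum_le_card_nsmul _ _
      (m • ENNReal.ofReal (2 * Real.exp (-t₁ * L + σ2 * t₁ ^ 2 / 2))) fun a _ => ?_).trans ?_)
    · refine (measure_biUnion_finset_le _ _).trans ((Finset.sum_le_card_nsmul _ _ _ fun i _ =>
        measure_abs_ge_le_of_gaussian (hmodel.channel_law a i) L ht₁).trans ?_)
      rw [Finset.card_univ, Fintype.card_fin]
    · rw [Finset.card_univ, Fintype.card_fin, nsmul_eq_mul, nsmul_eq_mul, mul_assoc,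
        ENNReal.ofReal_mul (Nat.cast_nonneg n), ENNReal.ofReal_mul (Nat.cast_nonneg m),
        ENNReal.ofReal_natCast, ENNReal.ofReal_natCast]
  · refine (measure_biUnion_finset_le _ _).trans ((Finset.sum_le_card_nsmul _ _ _ fun a _ =>
      measure_abs_ge_le_of_gaussian (hmodel.noise_law a) τ ht₂).trans ?_)
    rw [Finset.card_univ, Fintype.card_fin, nsmul_eq_mul,
      Real.coe_toNNReal _ (inv_nonneg.2 hρ.le), ENNReal.ofReal_mul (Nat.cast_nonneg n),
      ENNReal.ofReal_natCast]
  · rw [errorConst, mul_assoc, Finset.sum_mul, ENNReal.ofReal_sum_of_nonneg]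
    · refine (measure_biUnion_finset_le _ _).trans (Finset.sum_le_sum fun b hb => ?_)
      rw [Finset.sum_mul, ENNReal.ofReal_sum_of_nonneg]
      · refine (measure_biUnion_finset_le _ _).trans (Finset.sum_le_sum fun d hd => ?_)
        rw [Finset.sum_mul, ENNReal.ofReal_sum_of_nonneg]
        · exact (measure_biUnion_finset_le _ _).trans (Finset.sum_le_sum fun p _ => hU b hb d hd p)
        · intro p _
          have := pivotConst_nonneg n m d hD0
          positivity
      · intro d _
        have h := pivotConst_nonneg n m d hD0
        have := Finset.sum_nonneg (s := (Finset.univ : Finset (Fin (d + 1) → Fin m)))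
          fun _ _ => h
        positivity
    · intro b _
      refine mul_nonneg (Finset.sum_nonneg fun d _ => Finset.sum_nonneg fun p _ =>
        pivotConst_nonneg n m d hD0) (by positivity)

/-! ### Asymptotics -/

/-- Powers of `log ρ` do not affect the exponent. -/
theorem limsup_log_div_log_le {f : ℝ → ℝ≥0∞} {C : ℝ} (hC : 0 < C) (B : ℕ) (δ : ℝ)
    (hf : ∀ᶠ ρ in atTop, f ρ ≤
      ENNReal.ofReal (C * Real.log ρ ^ B * Real.exp (-δ * Real.log ρ))) :
    limsup (fun ρ : ℝ => ENNReal.log (f ρ) / ((Real.log ρ : ℝ) : EReal)) atTop ≤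
      ((-δ : ℝ) : EReal) := by
  have hlim : Tendsto (fun ρ : ℝ => Real.log C / Real.log ρ +
      B * (Real.log (Real.log ρ) / Real.log ρ) + -δ) atTop (nhds (-δ)) := by
    have h1 : Tendsto (fun ρ : ℝ => Real.log C / Real.log ρ) atTop (nhds 0) :=
      Real.tendsto_log_atTop.const_div_atTop _
    have h2 : Tendsto (fun ρ : ℝ => Real.log (Real.log ρ) / Real.log ρ) atTop (nhds 0) :=
      (Real.isLittleO_log_id_atTop.tendsto_div_nhds_zero).comp Real.tendsto_log_atTop
    simpa using (h1.add (h2.const_mul (B : ℝ))).add_const (-δ)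
  have hlim' := (continuous_coe_real_ereal.tendsto (-δ)).comp hlim
  refine (limsup_le_limsup ?_).trans hlim'.limsup_eq.le
  filter_upwards [hf, eventually_gt_atTop (Real.exp 1)] with ρ hρ hρ1
  have hLpos : 0 < Real.log ρ := Real.log_pos (by linarith [Real.add_one_le_exp 1])
  have hpos : 0 < C * Real.log ρ ^ B * Real.exp (-δ * Real.log ρ) := by positivity
  calc ENNReal.log (f ρ) / ((Real.log ρ : ℝ) : EReal)
      ≤ ((Real.log (C * Real.log ρ ^ B * Real.exp (-δ * Real.log ρ)) : ℝ) : EReal) /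
          ((Real.log ρ : ℝ) : EReal) := by
        refine EReal.div_le_div_right_of_nonneg (by exact_mod_cast hLpos.le) ?_
        rw [← ENNReal.log_ofReal_of_pos hpos]
        exact ENNReal.log_monotone hρ
    _ = _ := by
        rw [← EReal.coe_div]
        simp only [Function.comp]
        congr 1
        rw [Real.log_mul (by positivity) (by positivity), Real.log_mul hC.ne' (by positivity),
          Real.log_exp, Real.log_pow]
        field_simp

/-- The quantitative form of the theorem. Here `k = n - r(r+1)/2` is twice the diversity order, and
the bounds of the previous part are used with `L = log ρ`, `τ = log ρ / ρ^{1/2}` and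
`M = ⌊ρ^{1/2} / ((n + 1) log ρ)⌋`. -/
theorem eventually_measure_errorEvent_le {Ω : Type*} [MeasurableSpace Ω] {P : Measure Ω}
    [IsProbabilityMeasure P] {n m r k : ℕ} (hm : m = n + r) (hk : n = k + r * (r + 1) / 2)
    {σ2 : ℝ≥0} (hσ2 : σ2 ≠ 0) {H : Ω → Matrix (Fin n) (Fin m) ℝ} {s : Ω → Fin m → ℝ}
    {v : ℝ → Ω → Fin n → ℝ} (hmodel : ∀ ρ : ℝ, 0 < ρ → IsGaussianModel P σ2 ρ H s (v ρ))
    {Xstar : Matrix (Fin n) (Fin m) ℝ → (Fin n → ℝ) → Matrix (Fin m ⊕ Unit) (Fin m ⊕ Unit) ℝ}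
    (hXstar : ∀ G y, IsOptimal G y (Xstar G y)) :
    ∃ C : ℝ, 0 < C ∧ ∀ᶠ ρ in atTop, P (errorEvent Xstar H s (v ρ)) ≤
      ENNReal.ofReal (C * Real.log ρ ^ (n * m + m + k) *
        Real.exp (-((k : ℝ) / 2) * Real.log ρ)) := by
  set D : ℝ := (√(2 * Real.pi * σ2))⁻¹ with hDdef
  have hD0 : 0 ≤ D := by positivity
  have hE := errorConst_nonneg n m hD0
  set t : ℝ := (k : ℝ) / 2 with ht
  have ht0 : 0 ≤ t := by positivity
  set c₁ : ℝ := n * m * (2 * Real.exp (σ2 * t ^ 2 / 2)) with hc₁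
  set c₂ : ℝ := n * (2 * Real.exp (t ^ 2 / 2)) with hc₂
  set c₃ : ℝ := errorConst n m D * (1 + m) ^ (n * m) * 2 ^ m * (2 * (n + 1)) ^ k with hc₃
  refine ⟨c₁ + c₂ + c₃ + 1, by positivity, ?_⟩
  -- This makes the number whose floor is `M` at least two.
  have hbig : ∀ᶠ ρ : ℝ in atTop, 2 * (n + 1) * Real.log ρ ≤ √ρ := by
    have h := (isLittleO_log_rpow_atTop (r := 1 / 2) (by norm_num)).bound
      (c := (2 * ((n : ℝ) + 1))⁻¹) (by positivity)
    filter_upwards [h, eventually_ge_atTop 1] with ρ hρ hρ1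
    rw [Real.norm_of_nonneg (Real.log_nonneg hρ1), Real.norm_of_nonneg (by positivity),
      ← Real.sqrt_eq_rpow, inv_mul_eq_div, le_div_iff₀ (by positivity)] at hρ
    linarith
  filter_upwards [hbig, eventually_ge_atTop (Real.exp 1)] with ρ hρ hρ1
  have hρpos : 0 < ρ := (Real.exp_pos 1).trans_le hρ1
  set L : ℝ := Real.log ρ with hL
  have hL1 : 1 ≤ L := by rw [hL, Real.le_log_iff_exp_le hρpos]; exact hρ1
  set x : ℝ := √ρ with hx
  have hxpos : 0 < x := Real.sqrt_pos.2 hρpos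
  have hxx : x * x = ρ := Real.mul_self_sqrt hρpos.le
  -- `ρ ^ (-k / 2)` in the two forms used below.
  have hexpx : Real.exp (-t * L) = (x ^ k)⁻¹ := by
    have : x = Real.exp (L / 2) := by rw [hx, hL, Real.exp_half, Real.exp_log hρpos]
    rw [this, ← Real.exp_nat_mul, ← Real.exp_neg, ht]
    congr 1; ring
  set q : ℝ := x / ((n + 1) * L) with hq
  have hq2 : 2 ≤ q := by
    rw [hq, le_div_iff₀ (by positivity)]; linarith
  set M : ℕ := ⌊q⌋₊ with hM
  have hM2 : 2 ≤ M := Nat.le_floor (by exact_mod_cast hq2)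
  have hMq : (M : ℝ) ≤ q := Nat.floor_le (by linarith)
  have hqM : q / 2 ≤ M := by
    have := Nat.lt_floor_add_one q
    linarith
  have hMpos : (0 : ℝ) < M := by linarith
  have hMτ : M * ((n + 1) * (L / x)) ≤ 1 := by
    calc M * ((n + 1) * (L / x)) ≤ q * ((n + 1) * (L / x)) := by gcongr
      _ = 1 := by rw [hq]; field_simp
  -- The Chernoff parameters are chosen such that both tails are of order `ρ ^ (-k / 2)`.
  have hmain := measure_errorEvent_le hm hσ2 hρpos (hmodel ρ hρpos) hXstar (L := L) (by linarith)
    hM2 hMτ ht0 (t₂ := t * x) (by positivity)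
  refine hmain.trans (ENNReal.ofReal_le_ofReal ?_)
  have e1 : n * m * (2 * Real.exp (-t * L + σ2 * t ^ 2 / 2)) = c₁ * Real.exp (-t * L) := by
    rw [Real.exp_add, hc₁]; ring
  have e2 : n * (2 * Real.exp (-(t * x) * (L / x) + ρ⁻¹ * (t * x) ^ 2 / 2)) =
      c₂ * Real.exp (-t * L) := by
    have h1 : -(t * x) * (L / x) = -t * L := by field_simp
    have h2 : ρ⁻¹ * (t * x) ^ 2 / 2 = t ^ 2 / 2 := by rw [← hxx]; field_simp
    rw [h1, h2, Real.exp_add, hc₂]; ring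
  have hMx : (M : ℝ) ≤ ρ := by
    have h1 : q ≤ x := div_le_self hxpos.le (by nlinarith [(Nat.cast_nonneg n : (0 : ℝ) ≤ n)])
    have h2 : 1 ≤ x := by linarith
    nlinarith
  have hlogM : Real.log M ≤ L := Real.log_le_log hMpos hMx
  have hlogM0 : 0 ≤ Real.log M := Real.log_nonneg (by linarith)
  have hpow : (M : ℝ) ^ (r * (r + 1) / 2) / (M : ℝ) ^ n ≤ (2 * (n + 1)) ^ k * L ^ k * (x ^ k)⁻¹ := by
    conv_lhs => rw [hk]
    rw [pow_add, div_mul_cancel_right₀ (by positivity), ← inv_pow, ← inv_pow, ← mul_pow, ← mul_pow]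
    refine pow_le_pow_left₀ (by positivity) ?_ k
    rw [inv_le_comm₀ hMpos (by positivity)]
    refine le_trans (le_of_eq ?_) hqM
    rw [hq]
    field_simp
  have e3 : errorConst n m D * (1 + m * L) ^ (n * m) *
      ((1 + Real.log M) ^ m * ((M : ℝ) ^ (r * (r + 1) / 2) / (M : ℝ) ^ n)) ≤
      c₃ * L ^ (n * m + m + k) * Real.exp (-t * L) := by
    have h1 : 1 + m * L ≤ (1 + m) * L := by linarith
    have h2 : 1 + Real.log M ≤ 2 * L := by linarith
    calc _ ≤ errorConst n m D * ((1 + m) * L) ^ (n * m) *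
          ((2 * L) ^ m * ((2 * (n + 1)) ^ k * L ^ k * (x ^ k)⁻¹)) := by gcongr
      _ = _ := by rw [hexpx, hc₃, mul_pow, mul_pow, pow_add, pow_add]; ring
  have hLB : 1 ≤ L ^ (n * m + m + k) := one_le_pow₀ hL1
  rw [e1, e2]
  have hexp := Real.exp_pos (-t * L)
  have hc1 : 0 ≤ c₁ := by positivity
  have hc2 : 0 ≤ c₂ := by positivity
  calc _ ≤ c₁ * L ^ (n * m + m + k) * Real.exp (-t * L) +
        c₂ * L ^ (n * m + m + k) * Real.exp (-t * L) +
        c₃ * L ^ (n * m + m + k) * Real.exp (-t * L) := by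
        gcongr
        · exact le_mul_of_one_le_right hc1 hLB
        · exact le_mul_of_one_le_right hc2 hLB
    _ ≤ _ := by
        have : 0 ≤ L ^ (n * m + m + k) * Real.exp (-t * L) := by positivity
        linarith

end SDR

theorem theorem2 {Ω : Type*} [MeasurableSpace Ω] (P : Measure Ω) [IsProbabilityMeasure P]
    (n m r : ℕ) (hm : m = n + r) (hr : 0 < r) (σ2 : ℝ≥0) (hσ2 : σ2 ≠ 0)
    (H : Ω → Matrix (Fin n) (Fin m) ℝ) (s : Ω → Fin m → ℝ) (v : ℝ → Ω → Fin n → ℝ)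
    (hmodel : ∀ ρ : ℝ, 0 < ρ → SDR.IsGaussianModel P σ2 ρ H s (v ρ))
    (Xstar : Matrix (Fin n) (Fin m) ℝ → (Fin n → ℝ) → Matrix (Fin m ⊕ Unit) (Fin m ⊕ Unit) ℝ)
    (hXstar : ∀ G y, SDR.IsOptimal G y (Xstar G y)) :
    limsup (fun ρ : ℝ =>
        ENNReal.log (P (SDR.errorEvent Xstar H s (v ρ))) / ((Real.log ρ : ℝ) : EReal)) atTop ≤
      ((-((1 / 2 : ℝ) * ((m : ℝ) - (r : ℝ) * ((r : ℝ) + 3) / 2)) : ℝ) : EReal) := by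
  have hcast : ((r * (r + 1) / 2 : ℕ) : ℝ) = (r : ℝ) * (r + 1) / 2 := by
    rw [Nat.cast_div (Nat.even_mul_succ_self r).two_dvd (by norm_num)]
    push_cast
    ring
  rcases Nat.le_total (r * (r + 1) / 2) n with hle | hle
  · obtain ⟨k, hk⟩ := Nat.exists_eq_add_of_le' hle
    obtain ⟨C, hC, hev⟩ := SDR.eventually_measure_errorEvent_le hm hk hσ2 hmodel hXstar
    have hexp : (1 / 2 : ℝ) * ((m : ℝ) - (r : ℝ) * ((r : ℝ) + 3) / 2) = (k : ℝ) / 2 := by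
      have h1 : (n : ℝ) = k + (r : ℝ) * (r + 1) / 2 := by
        rw [← hcast]; exact_mod_cast hk
      rw [hm]
      push_cast
      rw [h1]
      ring
    rw [hexp]
    exact SDR.limsup_log_div_log_le hC _ _ hev
  -- The claimed exponent is nonnegative, and a probability is at most one.
  · have hle' : (n : ℝ) ≤ (r : ℝ) * (r + 1) / 2 := by rw [← hcast]; exact_mod_cast hle
    have hnonneg : (0 : ℝ) ≤ -((1 / 2 : ℝ) * ((m : ℝ) - (r : ℝ) * ((r : ℝ) + 3) / 2)) := by
      rw [hm]
      push_cast
      nlinarith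
    refine limsup_le_of_le (h := ?_)
    filter_upwards [eventually_ge_atTop 1] with ρ hρ
    refine le_trans (EReal.div_nonpos_of_nonpos_of_nonneg ?_ ?_) (EReal.coe_nonneg.2 hnonneg)
    · rw [← ENNReal.log_one]
      exact ENNReal.log_monotone prob_le_one
    · exact EReal.coe_nonneg.2 (Real.log_nonneg hρ)
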